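/- **Conventions.** For elements $x,y$ of a partially ordered set write $x\ll y$ if, for every increasing sequence $(z_n)_n$ that has a supremum with $y\le \sup_n z_n$, there is $n$ with $x\le z_n$. A *$\mathrm{Cu}$-semigroup* is a commutative monoid $S$ with a translation-invariant partial order in which $0$ is the least element, such that: (O1) every increasing sequence has a supremum; (O2) every element is the supremum of a $\ll$-increasing sequence; (O3) $x'\ll x$ and $y'\ll y$ imply $x'+y'\ll x+y$; (O4) $\sup_n(x_n+y_n)=\sup_n x_n+\sup_n y_n$ for all increasing sequences $(x_n)_n$, $(y_n)_n$. A *generalized $\mathrm{Cu}$-morphism* is an order-preserving monoid morphism between $\mathrm{Cu}$-semigroups that preserves suprema of increasing sequences; a *$\mathrm{Cu}$-morphism* is a generalized $\mathrm{Cu}$-morphism that also preserves $\ll$. A generalized $\mathrm{Cu}$-morphism $\varphi\colon S\to T$ is *almost unperforated* if $\varphi(x)\le\varphi(y)$ whenever $x,y\in S$ satisfy $(m+1)x\le my$ for some $m\in\mathbb N$. It is *almost divisible* if for every $k\in\mathbb N$ and all $x',x\in S$ with $x'\ll x$ there is $z\in T$ with $kz\le\varphi(x)$ and $\varphi(x')\le(k+1)z$.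 Let $Z=\mathbb N\sqcup(0,\infty]$ (the Cuntz semigroup of the Jiang–Su algebra $\mathcal Z$). The order and the addition on each of the two parts are the usual ones; for $n\in\mathbb N$ and $t\in(0,\infty]$ the sum $n+t$ is the element $n+t$ of $(0,\infty]$, and $n\le t$ iff $n<t$ as extended real numbers, while $t\le n$ iff $t\le n$ as extended real numbers. The element $1\in Z$ is the one in $\mathbb N$. For $\mathrm{Cu}$-semigroups $S,T$ let $S\otimes T$ be their tensor product as $\mathrm{Cu}$-semigroups, constructed as follows. On finite formal sums $\sum_i a_i\otimes b_i$ with $a_i\in S$, $b_i\in T$, let $\le$ be the smallest additive preorder for which $\otimes$ is biadditive, monotone in each variable, and $0\otimes b$ and $a\otimes 0$ are equivalent to $0$. Write $f\prec g$ if $f\le\sum_i a_i'\otimes b_i'$ and $\sum_i a_i\otimes b_i\le g$ for some $a_i'\ll a_i$ and $b_i'\ll b_i$. The elements of $S\otimes T$ are the sets $\{f : f\prec s_n\text{ for some }n\}$ for $\prec$-increasing sequences $(s_n)_n$ of formal sums, ordered by inclusion, with $I+J=\{h : h\le f+g\text{ for some }f\in I,\ g\in J\}$. For $a\in S$, $b\in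 T$, the element $a\otimes b\in S\otimes T$ is the set of all $f$ with $f\prec a'\otimes b'$ for some $a'\ll a$, $b'\ll b$. **Theorem.** Let $S_1,S_2,T$ be $\mathrm{Cu}$-semigroups, and let $\varphi_1\colon S_1\to S_2$ and $\varphi_2\colon S_2\to T$ be generalized $\mathrm{Cu}$-morphisms such that $\varphi_1$ is almost divisible and $\varphi_2$ is almost unperforated. Then there is a generalized $\mathrm{Cu}$-morphism $\beta\colon S_1\otimes Z\to T$ such that $\beta(x\otimes 1)=\varphi_2(\varphi_1(x))$ for all $x\in S_1$. If, moreover, $\varphi_1$ and $\varphi_2$ are $\mathrm{Cu}$-morphisms, then there is a $\mathrm{Cu}$-morphism $\beta\colon S_1\otimes Z\to T$ such that $\beta(x\otimes 1)=\varphi_2(\varphi_1(x))$ for all $x\in S_1$. -/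

import Mathlib

open scoped ENNReal

set_option linter.unusedSectionVars false

namespace Cu

/-! ## Abstract Cuntz semigroups and their morphisms -/

/-- The sequential way-below relation `x ≪ y`: every increasing sequence whose supremum exists and
dominates `y` has a term dominating `x`. -/
def WayBelow {S : Type*} [PartialOrder S] (x y : S) : Prop :=
  ∀ (z : ℕ → S) (w : S), Monotone z → IsLUB (Set.range z) w → y ≤ w → ∃ n, x ≤ z n

/-- A `Cu`-semigroup: a positively ordered commutative monoid satisfying (O1)-(O4). -/
class CuSemigroup (S : Type*) [AddCommMonoid S] [PartialOrder S] : Prop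
    extends IsOrderedAddMonoid S where
  zero_le' : ∀ x : S, 0 ≤ x
  exists_isLUB : ∀ x : ℕ → S, Monotone x → ∃ w, IsLUB (Set.range x) w
  exists_wayBelow_seq : ∀ x : S, ∃ s : ℕ → S,
    (∀ n, WayBelow (s n) (s (n + 1))) ∧ IsLUB (Set.range s) x
  wayBelow_add : ∀ {x' x y' y : S}, WayBelow x' x → WayBelow y' y → WayBelow (x' + y') (x + y)
  isLUB_add : ∀ {x y : ℕ → S} {a b : S}, Monotone x → Monotone y →
    IsLUB (Set.range x) a → IsLUB (Set.range y) b → IsLUB (Set.range fun n => x n + y n) (a + b)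

/-- A generalized `Cu`-morphism: an order-preserving monoid morphism that preserves suprema of
increasing sequences. -/
structure IsGeneralizedCuMorphism {S T : Type*} [AddCommMonoid S] [PartialOrder S] [CuSemigroup S]
    [AddCommMonoid T] [PartialOrder T] [CuSemigroup T] (φ : S → T) : Prop where
  map_zero : φ 0 = 0
  map_add : ∀ x y, φ (x + y) = φ x + φ y
  monotone : Monotone φ
  map_isLUB : ∀ (x : ℕ → S) (w : S), Monotone x → IsLUB (Set.range x) w →
    IsLUB (Set.range fun n => φ (x n)) (φ w)

/-- A `Cu`-morphism: a generalized `Cu`-morphism that preserves `≪`. -/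
structure IsCuMorphism {S T : Type*} [AddCommMonoid S] [PartialOrder S] [CuSemigroup S]
    [AddCommMonoid T] [PartialOrder T] [CuSemigroup T] (φ : S → T) : Prop
    extends IsGeneralizedCuMorphism φ where
  map_wayBelow : ∀ {x' x : S}, WayBelow x' x → WayBelow (φ x') (φ x)

/-- `φ` is almost unperforated: `(m + 1) x ≤ m y` implies `φ x ≤ φ y`. -/
def IsAlmostUnperforated {S T : Type*} [AddCommMonoid S] [PartialOrder S] [PartialOrder T]
    (φ : S → T) : Prop :=
  ∀ (m : ℕ) (x y : S), (m + 1) • x ≤ m • y → φ x ≤ φ y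

/-- `φ` is almost divisible: for `x' ≪ x` and `k ∈ ℕ` there is `z` in the codomain with
`k z ≤ φ x` and `φ x' ≤ (k + 1) z`. -/
def IsAlmostDivisible {S T : Type*} [PartialOrder S] [AddCommMonoid T] [PartialOrder T]
    (φ : S → T) : Prop :=
  ∀ (k : ℕ) (x' x : S), WayBelow x' x → ∃ z : T, k • z ≤ φ x ∧ φ x' ≤ (k + 1) • z

section Basic

variable {S : Type*}

theorem WayBelow.le [PartialOrder S] {x y : S} (h : WayBelow x y) : x ≤ y := by
  obtain ⟨n, hn⟩ := h (fun _ => y) y monotone_const (by simp) le_rfl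
  exact hn

theorem WayBelow.trans_le [PartialOrder S] {x y z : S} (h : WayBelow x y) (h' : y ≤ z) :
    WayBelow x z :=
  fun s w hs hw hz => h s w hs hw (h'.trans hz)

theorem WayBelow.le_trans [PartialOrder S] {x y z : S} (h : x ≤ y) (h' : WayBelow y z) :
    WayBelow x z :=
  fun s w hs hw hz => (h' s w hs hw hz).imp fun _ hn => h.trans hn

theorem wayBelow_seq_monotone [PartialOrder S] {s : ℕ → S}
    (h : ∀ n, WayBelow (s n) (s (n + 1))) : Monotone s :=
  monotone_nat_of_le_succ fun n => (h n).le

theorem wayBelow_seq_wayBelow [PartialOrder S] {s : ℕ → S} {x : S}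
    (h : ∀ n, WayBelow (s n) (s (n + 1))) (hx : IsLUB (Set.range s) x) (n : ℕ) :
    WayBelow (s n) x :=
  (h n).trans_le (hx.1 ⟨n + 1, rfl⟩)

theorem WayBelow.interpolate [AddCommMonoid S] [PartialOrder S] [CuSemigroup S] {x' x : S}
    (h : WayBelow x' x) : ∃ y, WayBelow x' y ∧ WayBelow y x := by
  obtain ⟨s, hs, hx⟩ := CuSemigroup.exists_wayBelow_seq x
  obtain ⟨n, hn⟩ := h s x (wayBelow_seq_monotone hs) hx le_rfl
  exact ⟨s (n + 1), (hs n).le_trans hn, wayBelow_seq_wayBelow hs hx _⟩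

end Basic

/-! ## The tensor product of `Cu`-semigroups

The tensor product `S ⊗ T` is the completion of the algebraic tensor product of positively ordered
monoids, endowed with the auxiliary relation induced by `≪` on both factors. An element of the
algebraic tensor product is represented by a formal sum `∑ aᵢ ⊗ bᵢ`, that is, a multiset of pairs.
An element of the completion is represented by the round ideal generated by an increasing sequence
for the auxiliary relation. -/

section Tensor

variable {S T : Type*} [AddCommMonoid S] [PartialOrder S] [AddCommMonoid T] [PartialOrder T]

/-- The preorder of the algebraic tensor product of positively ordered monoids, on formal sums: the
smallest additive preorder for which `(a, b) ↦ a ⊗ b` is biadditive, monotone, and zero if `a = 0`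
or `b = 0`. -/
inductive TensorLE : Multiset (S × T) → Multiset (S × T) → Prop
  | refl (f : Multiset (S × T)) : TensorLE f f
  | trans {f g h : Multiset (S × T)} : TensorLE f g → TensorLE g h → TensorLE f h
  | add {f g f' g' : Multiset (S × T)} :
      TensorLE f g → TensorLE f' g' → TensorLE (f + f') (g + g')
  | mono {a a' : S} {b b' : T} : a ≤ a' → b ≤ b' → TensorLE {(a, b)} {(a', b')}
  | add_left_le (a a' : S) (b : T) : TensorLE {(a + a', b)} ({(a, b)} + {(a', b)})
  | le_add_left (a a' : S) (b : T) : TensorLE ({(a, b)} + {(a', b)}) {(a + a', b)}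
  | add_right_le (a : S) (b b' : T) : TensorLE {(a, b + b')} ({(a, b)} + {(a, b')})
  | le_add_right (a : S) (b b' : T) : TensorLE ({(a, b)} + {(a, b')}) {(a, b + b')}
  | zero_left_le (b : T) : TensorLE {(0, b)} 0
  | le_zero_left (b : T) : TensorLE 0 {(0, b)}
  | zero_right_le (a : S) : TensorLE {(a, 0)} 0
  | le_zero_right (a : S) : TensorLE 0 {(a, 0)}

/-- The auxiliary relation on formal sums: `f ≺ g` if `f ≤ ∑ aᵢ' ⊗ bᵢ'` and `∑ aᵢ ⊗ bᵢ ≤ g` with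
`aᵢ' ≪ aᵢ` and `bᵢ' ≪ bᵢ` for all `i`. -/
def TensorPrec (f g : Multiset (S × T)) : Prop :=
  ∃ f' g', TensorLE f f' ∧
    Multiset.Rel (fun p q => WayBelow p.1 q.1 ∧ WayBelow p.2 q.2) f' g' ∧ TensorLE g' g

variable (S T) in
/-- The tensor product of `S` and `T`: the sets `{f | ∃ n, f ≺ s n}` for sequences
`s 0 ≺ s 1 ≺ s 2 ≺ ⋯` of formal sums. -/
def CuTensor : Type _ :=
  {I : Set (Multiset (S × T)) // ∃ s : ℕ → Multiset (S × T),
    (∀ n, TensorPrec (s n) (s (n + 1))) ∧ I = {f | ∃ n, TensorPrec f (s n)}}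

/-- The order of the tensor product is inclusion of ideals. -/
instance : PartialOrder (CuTensor S T) := Subtype.partialOrder _

variable [CuSemigroup S] [CuSemigroup T]

theorem tensorLE_of_rel {f g : Multiset (S × T)}
    (h : Multiset.Rel (fun p q => WayBelow p.1 q.1 ∧ WayBelow p.2 q.2) f g) : TensorLE f g := by
  induction h with
  | zero => exact .refl _
  | cons h _ ih =>
    rw [← Multiset.singleton_add, ← Multiset.singleton_add]
    exact .add (.mono h.1.le h.2.le) ih

theorem TensorPrec.le {f g : Multiset (S × T)} (h : TensorPrec f g) : TensorLE f g := by
  obtain ⟨f', g', h1, h2, h3⟩ := h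
  exact h1.trans ((tensorLE_of_rel h2).trans h3)

theorem TensorPrec.trans_le {f g h : Multiset (S × T)} (h1 : TensorPrec f g) (h2 : TensorLE g h) :
    TensorPrec f h := by
  obtain ⟨f', g', h3, h4, h5⟩ := h1
  exact ⟨f', g', h3, h4, h5.trans h2⟩

theorem TensorLE.trans_prec {f g h : Multiset (S × T)} (h1 : TensorLE f g) (h2 : TensorPrec g h) :
    TensorPrec f h := by
  obtain ⟨f', g', h3, h4, h5⟩ := h2
  exact ⟨f', g', h1.trans h3, h4, h5⟩

theorem TensorPrec.add {f g f' g' : Multiset (S × T)} (h1 : TensorPrec f g)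
    (h2 : TensorPrec f' g') : TensorPrec (f + f') (g + g') := by
  obtain ⟨u, v, h3, h4, h5⟩ := h1
  obtain ⟨u', v', h3', h4', h5'⟩ := h2
  exact ⟨u + u', v + v', h3.add h3', h4.add h4', h5.add h5'⟩

theorem TensorLE.zero_le (f : Multiset (S × T)) : TensorLE 0 f := by
  induction f using Multiset.induction with
  | empty => exact .refl _
  | cons p f ih =>
    rw [← Multiset.singleton_add, ← zero_add (0 : Multiset (S × T))]
    exact .add ((TensorLE.le_zero_left p.2).trans (.mono (CuSemigroup.zero_le' _) le_rfl)) ih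

theorem TensorPrec.zero (f : Multiset (S × T)) : TensorPrec 0 f :=
  ⟨0, 0, .refl _, .zero, .zero_le f⟩

theorem TensorPrec.singleton {a' a : S} {b' b : T} (ha : WayBelow a' a) (hb : WayBelow b' b) :
    TensorPrec {(a', b')} {(a, b)} :=
  ⟨_, _, .refl _, .cons ⟨ha, hb⟩ .zero, .refl _⟩

theorem prec_seq_mono {s : ℕ → Multiset (S × T)} (hs : ∀ n, TensorPrec (s n) (s (n + 1)))
    {m n : ℕ} (h : m ≤ n) : TensorLE (s m) (s n) := by
  induction h with
  | refl => exact .refl _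
  | step _ ih => exact ih.trans (hs _).le

namespace CuTensor

theorem down (I : CuTensor S T) {f g : Multiset (S × T)} (h : TensorLE f g) (hg : g ∈ I.1) :
    f ∈ I.1 := by
  obtain ⟨I, s, hs, rfl⟩ := I
  obtain ⟨n, hn⟩ := hg
  exact ⟨n, h.trans_prec hn⟩

theorem directed (I : CuTensor S T) {f g : Multiset (S × T)} (hf : f ∈ I.1) (hg : g ∈ I.1) :
    ∃ h ∈ I.1, TensorPrec f h ∧ TensorPrec g h := by
  obtain ⟨I, s, hs, rfl⟩ := I
  obtain ⟨m, hm⟩ := hf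
  obtain ⟨n, hn⟩ := hg
  exact ⟨s (max m n), ⟨_, hs _⟩, hm.trans_le (prec_seq_mono hs (le_max_left _ _)),
    hn.trans_le (prec_seq_mono hs (le_max_right _ _))⟩

theorem exists_seq (I : CuTensor S T) : ∃ s : ℕ → Multiset (S × T),
    (∀ n, TensorPrec (s n) (s (n + 1))) ∧ (∀ n, s n ∈ I.1) ∧
      ∀ f ∈ I.1, ∃ n, TensorPrec f (s n) := by
  obtain ⟨I, s, hs, rfl⟩ := I
  exact ⟨s, hs, fun n => ⟨n + 1, hs n⟩, fun f hf => hf⟩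

/-- The zero of the tensor product: the ideal of formal sums below `0`. -/
instance : Zero (CuTensor S T) :=
  ⟨⟨{f | TensorLE f 0}, fun _ => 0, fun _ => .zero 0, Set.ext fun _ =>
    ⟨fun h => ⟨0, h.trans_prec (.zero 0)⟩, fun ⟨_, h⟩ => h.le⟩⟩⟩

/-- The sum of two ideals: the ideal of formal sums below `f + g` with `f ∈ I` and `g ∈ J`. -/
instance : Add (CuTensor S T) :=
  ⟨fun I J => ⟨{h | ∃ f ∈ I.1, ∃ g ∈ J.1, TensorLE h (f + g)}, by
    obtain ⟨s, hs, hsI, hI⟩ := I.exists_seq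
    obtain ⟨t, ht, htJ, hJ⟩ := J.exists_seq
    refine ⟨fun n => s n + t n, fun n => (hs n).add (ht n), Set.ext fun h => ⟨?_, ?_⟩⟩
    · rintro ⟨f, hf, g, hg, hh⟩
      obtain ⟨m, hm⟩ := hI f hf
      obtain ⟨n, hn⟩ := hJ g hg
      exact ⟨max m n, hh.trans_prec
        ((hm.trans_le (prec_seq_mono hs (le_max_left _ _))).add
          (hn.trans_le (prec_seq_mono ht (le_max_right _ _))))⟩
    · rintro ⟨n, hn⟩
      exact ⟨s n, hsI n, t n, htJ n, hn.le⟩⟩⟩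

theorem mem_zero {f : Multiset (S × T)} : f ∈ (0 : CuTensor S T).1 ↔ TensorLE f 0 := Iff.rfl

theorem mem_add {I J : CuTensor S T} {h : Multiset (S × T)} :
    h ∈ (I + J).1 ↔ ∃ f ∈ I.1, ∃ g ∈ J.1, TensorLE h (f + g) := Iff.rfl

theorem le_iff {I J : CuTensor S T} : I ≤ J ↔ ∀ f ∈ I.1, f ∈ J.1 := Iff.rfl

theorem add_le_add_aux {I I' J J' : CuTensor S T} (h : I ≤ I') (h' : J ≤ J') :
    I + J ≤ I' + J' := by
  rintro x ⟨f, hf, g, hg, hx⟩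
  exact ⟨f, h hf, g, h' hg, hx⟩

theorem add_comm_le (I J : CuTensor S T) : I + J ≤ J + I := by
  rintro x ⟨f, hf, g, hg, hx⟩
  exact ⟨g, hg, f, hf, by rwa [add_comm]⟩

theorem zero_le_aux (I : CuTensor S T) : 0 ≤ I := by
  intro f hf
  obtain ⟨s, _, hsI, _⟩ := I.exists_seq
  exact I.down (TensorLE.trans hf (.zero_le _)) (hsI 0)

theorem add_assoc_le (I J K : CuTensor S T) : I + J + K ≤ I + (J + K) := by
  rintro x ⟨u, ⟨f, hf, g, hg, hu⟩, k, hk, hx⟩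
  refine ⟨f, hf, g + k, ⟨g, hg, k, hk, .refl _⟩, ?_⟩
  rw [← add_assoc]
  exact hx.trans (hu.add (.refl _))

theorem zero_add_aux (I : CuTensor S T) : 0 + I = I := by
  refine le_antisymm ?_ fun f hf => ⟨0, .refl _, f, hf, by rw [zero_add]; exact .refl _⟩
  rintro x ⟨f, hf, g, hg, hx⟩
  have h := TensorLE.add hf (.refl g)
  rw [zero_add] at h
  exact I.down (hx.trans h) hg

instance : AddCommMonoid (CuTensor S T) where
  add_assoc I J K := by
    refine le_antisymm (add_assoc_le I J K) ?_
    calc I + (J + K) ≤ (J + K) + I := add_comm_le _ _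
      _ ≤ J + (K + I) := add_assoc_le _ _ _
      _ ≤ (K + I) + J := add_comm_le _ _
      _ ≤ K + (I + J) := add_assoc_le _ _ _
      _ ≤ I + J + K := add_comm_le _ _
  zero_add := zero_add_aux
  add_zero I := by
    rw [le_antisymm (add_comm_le I 0) (add_comm_le 0 I), zero_add_aux]
  add_comm I J := le_antisymm (add_comm_le _ _) (add_comm_le _ _)
  nsmul := nsmulRec

/-- The pure tensor `a ⊗ b`: the ideal of formal sums `f` with `f ≺ a' ⊗ b'` for some `a' ≪ a` and
`b' ≪ b`. -/
def tmul (a : S) (b : T) : CuTensor S T :=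
  ⟨{f | ∃ a' b', WayBelow a' a ∧ WayBelow b' b ∧ TensorPrec f {(a', b')}}, by
    obtain ⟨s, hs, ha⟩ := CuSemigroup.exists_wayBelow_seq a
    obtain ⟨t, ht, hb⟩ := CuSemigroup.exists_wayBelow_seq b
    refine ⟨fun n => {(s n, t n)}, fun n => .singleton (hs n) (ht n),
      Set.ext fun f => ⟨?_, ?_⟩⟩
    · rintro ⟨a', b', ha', hb', hf⟩
      obtain ⟨m, hm⟩ := ha' s a (wayBelow_seq_monotone hs) ha le_rfl
      obtain ⟨n, hn⟩ := hb' t b (wayBelow_seq_monotone ht) hb le_rfl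
      exact ⟨max m n, hf.trans_le
        (.mono (hm.trans (wayBelow_seq_monotone hs (le_max_left _ _)))
          (hn.trans (wayBelow_seq_monotone ht (le_max_right _ _))))⟩
    · rintro ⟨n, hn⟩
      exact ⟨s n, t n, wayBelow_seq_wayBelow hs ha n, wayBelow_seq_wayBelow ht hb n, hn⟩⟩

theorem exists_iUnion (I : ℕ → CuTensor S T) (hI : Monotone I) :
    ∃ U : CuTensor S T, ∀ f, f ∈ U.1 ↔ ∃ n, f ∈ (I n).1 := by
  choose s hs hsI hcof using fun n => (I n).exists_seq
  let V : Set (Multiset (S × T)) := {f | ∃ n, f ∈ (I n).1}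
  have hdir : ∀ f g : V, ∃ h : V, TensorPrec f.1 h.1 ∧ TensorPrec g.1 h.1 := by
    rintro ⟨f, m, hf⟩ ⟨g, n, hg⟩
    obtain ⟨h, hh, h1, h2⟩ := (I (max m n)).directed (hI (le_max_left _ _) hf)
      (hI (le_max_right _ _) hg)
    exact ⟨⟨h, _, hh⟩, h1, h2⟩
  choose d hd1 hd2 using hdir
  let e : ℕ → V := fun k => ⟨s k.unpair.1 k.unpair.2, _, hsI _ _⟩
  let t : ℕ → V := fun n => Nat.rec (e 0) (fun k u => d u (e k)) n
  have htV : ∀ f, (∃ n, TensorPrec f (t n).1) → f ∈ V := by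
    rintro f ⟨n, hn⟩
    obtain ⟨m, hm⟩ := (t n).2
    exact ⟨m, (I m).down hn.le hm⟩
  refine ⟨⟨V, fun n => (t n).1, fun n => hd1 _ _, Set.ext fun f => ⟨?_, htV f⟩⟩,
    fun f => Iff.rfl⟩
  rintro ⟨n, hn⟩
  obtain ⟨m, hm⟩ := hcof n f hn
  refine ⟨Nat.pair n m + 1, TensorLE.trans_prec hm.le ?_⟩
  have h := hd2 (t (Nat.pair n m)) (e (Nat.pair n m))
  have he : (e (Nat.pair n m)).1 = s n m := by simp [e]
  rw [he] at h
  exact h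

theorem isLUB_iff {I : ℕ → CuTensor S T} (hI : Monotone I) {U : CuTensor S T} :
    IsLUB (Set.range I) U ↔ ∀ f, f ∈ U.1 ↔ ∃ n, f ∈ (I n).1 := by
  have key : ∀ {V : CuTensor S T}, (∀ f, f ∈ V.1 ↔ ∃ n, f ∈ (I n).1) →
      IsLUB (Set.range I) V := by
    intro V hV
    refine ⟨?_, fun W hW f hf => ?_⟩
    · rintro _ ⟨n, rfl⟩ f hf
      exact (hV f).2 ⟨n, hf⟩
    · obtain ⟨n, hn⟩ := (hV f).1 hf
      exact hW ⟨n, rfl⟩ hn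
  refine ⟨fun h => ?_, key⟩
  obtain ⟨V, hV⟩ := exists_iUnion I hI
  rwa [h.unique (key hV)]

theorem wayBelow_of_mem {I J : CuTensor S T} {g : Multiset (S × T)} (hg : g ∈ J.1)
    (h : ∀ f ∈ I.1, TensorLE f g) : WayBelow I J := by
  intro Z W hZ hW hJ
  obtain ⟨n, hn⟩ := ((isLUB_iff hZ).1 hW g).1 (hJ hg)
  exact ⟨n, fun f hf => (Z n).down (h f hf) hn⟩

theorem mem_sum_of_rel {f g : Multiset (S × T)}
    (h : Multiset.Rel (fun p q => WayBelow p.1 q.1 ∧ WayBelow p.2 q.2) f g) :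
    f ∈ ((g.map fun p => tmul p.1 p.2).sum : CuTensor S T).1 := by
  induction h with
  | zero => exact .refl _
  | @cons p q f g hpq _ ih =>
    rw [Multiset.map_cons, Multiset.sum_cons, ← Multiset.singleton_add]
    obtain ⟨a, ha, ha'⟩ := hpq.1.interpolate
    obtain ⟨b, hb, hb'⟩ := hpq.2.interpolate
    exact ⟨{p}, ⟨a, b, ha', hb', .singleton ha hb⟩, f, ih, .refl _⟩

theorem le_of_mem_sum {f g : Multiset (S × T)}
    (h : f ∈ ((g.map fun p => tmul p.1 p.2).sum : CuTensor S T).1) : TensorLE f g := by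
  induction g using Multiset.induction generalizing f with
  | empty => exact h
  | cons p g ih =>
    rw [Multiset.map_cons, Multiset.sum_cons] at h
    obtain ⟨u, ⟨a, b, ha, hb, hu⟩, v, hv, hf⟩ := h
    rw [← Multiset.singleton_add]
    exact hf.trans (.add (hu.le.trans (.mono ha.le hb.le)) (ih hv))

theorem exists_wayBelow_seq_aux (I : CuTensor S T) : ∃ J : ℕ → CuTensor S T,
    (∀ n, WayBelow (J n) (J (n + 1))) ∧ IsLUB (Set.range J) I := by
  obtain ⟨s, hs, hsI, hcof⟩ := I.exists_seq
  choose u v hu huv hv using hs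
  let J : ℕ → CuTensor S T := fun n => ((v n).map fun p => tmul p.1 p.2).sum
  have h1 : ∀ n, s n ∈ (J n).1 := fun n => (J n).down (hu n) (mem_sum_of_rel (huv n))
  have h2 : ∀ n, ∀ f ∈ (J n).1, TensorLE f (s (n + 1)) :=
    fun n f hf => (le_of_mem_sum hf).trans (hv n)
  have h3 : ∀ n, WayBelow (J n) (J (n + 1)) := fun n => wayBelow_of_mem (h1 (n + 1)) (h2 n)
  refine ⟨J, h3, (isLUB_iff (wayBelow_seq_monotone h3)).2 fun f => ⟨fun hf => ?_, ?_⟩⟩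
  · obtain ⟨n, hn⟩ := hcof f hf
    exact ⟨n, (J n).down hn.le (h1 n)⟩
  · rintro ⟨n, hn⟩
    exact I.down (h2 n f hn) (hsI _)

theorem exists_mem_of_wayBelow {I J : CuTensor S T} (h : WayBelow I J) :
    ∃ g ∈ J.1, ∀ f ∈ I.1, TensorLE f g := by
  obtain ⟨s, hs, hsJ, hcof⟩ := J.exists_seq
  choose u v hu huv hv using hs
  let K : ℕ → CuTensor S T := fun n => ((v n).map fun p => tmul p.1 p.2).sum
  have h1 : ∀ n, s n ∈ (K n).1 := fun n => (K n).down (hu n) (mem_sum_of_rel (huv n))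
  have h2 : ∀ n, ∀ f ∈ (K n).1, TensorLE f (s (n + 1)) :=
    fun n f hf => (le_of_mem_sum hf).trans (hv n)
  have h3 : Monotone K := wayBelow_seq_monotone fun n => wayBelow_of_mem (h1 (n + 1)) (h2 n)
  have h4 : IsLUB (Set.range K) J := by
    refine (isLUB_iff h3).2 fun f => ⟨fun hf => ?_, ?_⟩
    · obtain ⟨n, hn⟩ := hcof f hf
      exact ⟨n, (K n).down hn.le (h1 n)⟩
    · rintro ⟨n, hn⟩
      exact J.down (h2 n f hn) (hsJ _)
  obtain ⟨n, hn⟩ := h K J h3 h4 le_rfl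
  exact ⟨s (n + 1), hsJ _, fun f hf => h2 n f (hn hf)⟩

instance : CuSemigroup (CuTensor S T) where
  add_le_add_left I J h K := add_le_add_aux h le_rfl
  zero_le' := zero_le_aux
  exists_isLUB I hI := by
    obtain ⟨U, hU⟩ := exists_iUnion I hI
    exact ⟨U, (isLUB_iff hI).2 hU⟩
  exists_wayBelow_seq := exists_wayBelow_seq_aux
  wayBelow_add {I' I J' J} h h' := by
    obtain ⟨f, hf, hI⟩ := exists_mem_of_wayBelow h
    obtain ⟨g, hg, hJ⟩ := exists_mem_of_wayBelow h'
    refine wayBelow_of_mem (g := f + g) ⟨f, hf, g, hg, .refl _⟩ ?_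
    rintro x ⟨u, hu, v, hv, hx⟩
    exact hx.trans ((hI u hu).add (hJ v hv))
  isLUB_add {I J A B} hI hJ hA hB := by
    rw [isLUB_iff hI] at hA
    rw [isLUB_iff hJ] at hB
    refine (isLUB_iff fun m n h => add_le_add_aux (hI h) (hJ h)).2 fun x => ⟨?_, ?_⟩
    · rintro ⟨f, hf, g, hg, hx⟩
      obtain ⟨m, hm⟩ := (hA f).1 hf
      obtain ⟨n, hn⟩ := (hB g).1 hg
      exact ⟨max m n, f, hI (le_max_left _ _) hm, g, hJ (le_max_right _ _) hn, hx⟩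
    · rintro ⟨n, f, hf, g, hg, hx⟩
      exact ⟨f, (hA f).2 ⟨n, hf⟩, g, (hB g).2 ⟨n, hg⟩, hx⟩

end CuTensor

end Tensor

/-! ## The Cuntz semigroup of the Jiang-Su algebra -/

/-- The set `Z = ℕ ⊔ (0, ∞]`, with compact elements `n ∈ ℕ` and nonzero soft elements
`t ∈ (0, ∞]`. -/
inductive CuZ : Type
  | compact (n : ℕ) : CuZ
  | soft (t : ℝ≥0∞) (ht : 0 < t) : CuZ

namespace CuZ

/-- The underlying value in `[0, ∞]`, i.e. the soft retraction. -/
def val : CuZ → ℝ≥0∞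
  | compact n => n
  | soft t _ => t

/-- The order of `Z`: the usual one on `ℕ` and on `(0, ∞]`; a compact `n` is below a soft `t` iff
`n < t`, and a soft `t` is below a compact `n` iff `t ≤ n`. -/
protected def le : CuZ → CuZ → Prop
  | compact m, compact n => m ≤ n
  | compact m, soft t _ => (m : ℝ≥0∞) < t
  | soft t _, compact n => t ≤ n
  | soft s _, soft t _ => s ≤ t

/-- The addition of `Z`: the usual one on `ℕ` and on `(0, ∞]`; the sum of a compact `n` and a soft
`t` is the soft `n + t`. -/
protected def add : CuZ → CuZ → CuZ
  | compact m, compact n => compact (m + n)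
  | compact m, soft t ht => soft (m + t) (ht.trans_le le_add_self)
  | soft t ht, compact n => soft (t + n) (ht.trans_le le_self_add)
  | soft s hs, soft t _ => soft (s + t) (hs.trans_le le_self_add)

instance : LE CuZ := ⟨CuZ.le⟩
instance : Add CuZ := ⟨CuZ.add⟩
instance : Zero CuZ := ⟨compact 0⟩
instance : One CuZ := ⟨compact 1⟩

theorem compact_le_compact {m n : ℕ} : compact m ≤ compact n ↔ m ≤ n := Iff.rfl
theorem compact_le_soft {m : ℕ} {t : ℝ≥0∞} {ht : 0 < t} :
    compact m ≤ soft t ht ↔ (m : ℝ≥0∞) < t := Iff.rfl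
theorem soft_le_iff {t : ℝ≥0∞} {ht : 0 < t} {u : CuZ} : soft t ht ≤ u ↔ t ≤ u.val := by
  cases u <;> exact Iff.rfl
theorem zero_def : (0 : CuZ) = compact 0 := rfl
theorem compact_add_compact (m n : ℕ) : compact m + compact n = compact (m + n) := rfl
theorem compact_add_soft (m : ℕ) (t : ℝ≥0∞) (ht : 0 < t) :
    compact m + soft t ht = soft (m + t) (ht.trans_le le_add_self) := rfl
theorem soft_add_compact (m : ℕ) (t : ℝ≥0∞) (ht : 0 < t) :
    soft t ht + compact m = soft (t + m) (ht.trans_le le_self_add) := rfl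
theorem soft_add_soft (s t : ℝ≥0∞) (hs : 0 < s) (ht : 0 < t) :
    soft s hs + soft t ht = soft (s + t) (hs.trans_le le_self_add) := rfl

@[simp] theorem val_compact (n : ℕ) : (compact n).val = n := rfl
@[simp] theorem val_soft (t : ℝ≥0∞) (ht : 0 < t) : (soft t ht).val = t := rfl

theorem val_add (u v : CuZ) : (u + v).val = u.val + v.val := by
  cases u <;> cases v <;>
    simp [compact_add_compact, compact_add_soft, soft_add_compact, soft_add_soft]

theorem val_mono {u v : CuZ} (h : u ≤ v) : u.val ≤ v.val := by
  cases u with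
  | compact m =>
    cases v with
    | compact n => exact Nat.cast_le.2 (compact_le_compact.1 h)
    | soft t ht => exact (compact_le_soft.1 h).le
  | soft s hs => exact soft_le_iff.1 h

theorem le_of_val_lt {u v : CuZ} (h : u.val < v.val) : u ≤ v := by
  cases u with
  | compact m =>
    cases v with
    | compact n => exact compact_le_compact.2 (Nat.cast_lt.1 h).le
    | soft t ht => exact h
  | soft s hs => exact soft_le_iff.2 h.le

noncomputable instance : LinearOrder CuZ where
  le_refl u := by
    cases u with
    | compact m => exact compact_le_compact.2 le_rfl
    | soft s hs => exact soft_le_iff.2 le_rfl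
  le_trans u v w h h' := by
    cases u with
    | soft s hs => exact soft_le_iff.2 ((soft_le_iff.1 h).trans (val_mono h'))
    | compact m =>
      cases v with
      | soft t ht => exact le_of_val_lt (lt_of_lt_of_le (compact_le_soft.1 h) (val_mono h'))
      | compact n =>
        cases w with
        | soft t ht =>
          exact compact_le_soft.2 (lt_of_le_of_lt (val_mono h) (compact_le_soft.1 h'))
        | compact k =>
          exact compact_le_compact.2 ((compact_le_compact.1 h).trans (compact_le_compact.1 h'))
  le_antisymm u v h h' := by
    cases u with
    | compact m =>
      cases v with
      | compact n =>
        rw [le_antisymm (compact_le_compact.1 h) (compact_le_compact.1 h')]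
      | soft t ht => exact absurd (compact_le_soft.1 h) (not_lt.2 (soft_le_iff.1 h'))
    | soft s hs =>
      cases v with
      | compact n => exact absurd (compact_le_soft.1 h') (not_lt.2 (soft_le_iff.1 h))
      | soft t ht =>
        obtain rfl := le_antisymm (soft_le_iff.1 h) (soft_le_iff.1 h')
        rfl
  le_total u v := by
    rcases lt_trichotomy u.val v.val with h | h | h
    · exact .inl (le_of_val_lt h)
    · cases u with
      | soft s hs => exact .inl (soft_le_iff.2 h.le)
      | compact m =>
        cases v with
        | soft t ht => exact .inr (soft_le_iff.2 h.ge)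
        | compact n => exact .inl (compact_le_compact.2 (Nat.cast_le.1 h.le))
    · exact .inr (le_of_val_lt h)
  toDecidableLE := Classical.decRel _

theorem ext_aux {u v : CuZ} (h : u.val = v.val)
    (h' : (∃ n, u = compact n) ↔ ∃ n, v = compact n) : u = v := by
  cases u with
  | compact m =>
    obtain ⟨n, rfl⟩ := h'.1 ⟨m, rfl⟩
    rw [Nat.cast_injective (R := ℝ≥0∞) h]
  | soft s hs =>
    cases v with
    | compact n => obtain ⟨_, h⟩ := h'.2 ⟨n, rfl⟩; cases h
    | soft t ht => obtain rfl : s = t := h; rfl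

theorem add_isCompact {u v : CuZ} :
    (∃ n, u + v = compact n) ↔ (∃ n, u = compact n) ∧ ∃ n, v = compact n := by
  cases u <;> cases v <;>
    simp [compact_add_compact, compact_add_soft, soft_add_compact, soft_add_soft]

instance : AddCommMonoid CuZ where
  add_assoc u v w := ext_aux (by simp only [val_add, add_assoc])
    (by simp only [add_isCompact, and_assoc])
  zero_add u := ext_aux (by simp [val_add, zero_def]) (by simp [add_isCompact, zero_def])
  add_zero u := ext_aux (by simp [val_add, zero_def]) (by simp [add_isCompact, zero_def])
  add_comm u v := ext_aux (by simp only [val_add, add_comm])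
    (by simp only [add_isCompact, and_comm])
  nsmul := nsmulRec

theorem add_le_add_aux {u v : CuZ} (w : CuZ) (h : u ≤ v) : u + w ≤ v + w := by
  have hval : (u + w).val ≤ (v + w).val := by
    rw [val_add, val_add]; gcongr; exact val_mono h
  cases hu : u + w with
  | soft s hs => rw [hu] at hval; exact soft_le_iff.2 hval
  | compact k =>
    obtain ⟨⟨m, rfl⟩, ⟨n, rfl⟩⟩ := add_isCompact.1 ⟨k, hu⟩
    rw [← hu]
    cases v with
    | compact l =>
      exact compact_le_compact.2 (Nat.add_le_add_right (compact_le_compact.1 h) n)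
    | soft t ht =>
      refine le_of_val_lt ?_
      rw [val_add, val_add]
      exact ENNReal.add_lt_add_right (ENNReal.natCast_ne_top n) (compact_le_soft.1 h)

theorem wayBelow_of_lt {u v : CuZ} (h : u < v) : WayBelow u v := by
  intro z w _ hw hv
  by_contra! hc
  exact absurd (hv.trans (hw.2 (by rintro _ ⟨n, rfl⟩; exact (hc n).le))) (not_le.2 h)

theorem wayBelow_compact (n : ℕ) : WayBelow (compact n) (compact n) := by
  intro z w _ hw hv
  by_contra! hc
  cases n with
  | zero => exact absurd (hc 0) (not_lt.2 (by
      cases z 0 with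
      | compact m => exact compact_le_compact.2 (Nat.zero_le m)
      | soft t ht => exact compact_le_soft.2 (by simpa using ht)))
  | succ m =>
    have hpos : (0 : ℝ≥0∞) < ((m + 1 : ℕ) : ℝ≥0∞) := by exact_mod_cast Nat.succ_pos m
    have hb : w ≤ soft ((m + 1 : ℕ) : ℝ≥0∞) hpos := by
      refine hw.2 ?_
      rintro _ ⟨k, rfl⟩
      have hk := hc k
      cases hz : z k with
      | compact j =>
        rw [hz] at hk
        have : j < m + 1 := by
          by_contra! hj
          exact absurd hk (not_lt.2 (compact_le_compact.2 hj))
        exact compact_le_soft.2 (Nat.cast_lt.2 this)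
      | soft t ht =>
        rw [hz] at hk
        exact soft_le_iff.2 ((soft_le_iff (ht := ht)).1 hk.le)
    exact absurd (compact_le_soft.1 (hv.trans hb)) (lt_irrefl _)

theorem exists_wayBelow_seq_aux (u : CuZ) : ∃ s : ℕ → CuZ,
    (∀ n, WayBelow (s n) (s (n + 1))) ∧ IsLUB (Set.range s) u := by
  cases u with
  | compact n => exact ⟨fun _ => compact n, fun _ => wayBelow_compact n, by simp⟩
  | soft t ht =>
    obtain ⟨r, hr, hrt, hlim⟩ := exists_seq_strictMono_tendsto' ht
    have hlt : ∀ n, soft (r n) (hrt n).1 < soft (r (n + 1)) (hrt (n + 1)).1 := fun n =>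
      not_le.1 fun h => absurd (soft_le_iff.1 h) (not_le.2 (hr (Nat.lt_succ_self n)))
    refine ⟨fun n => soft (r n) (hrt n).1, fun n => wayBelow_of_lt (hlt n), ?_, ?_⟩
    · rintro _ ⟨n, rfl⟩
      exact soft_le_iff.2 (hrt n).2.le
    · intro w hw
      exact soft_le_iff.2 (le_of_tendsto' hlim fun n => soft_le_iff.1 (hw ⟨n, rfl⟩))

theorem val_lt_of_wayBelow_soft {u : CuZ} {t : ℝ≥0∞} {ht : 0 < t}
    (h : WayBelow u (soft t ht)) : u.val < t := by
  cases u with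
  | compact m => exact compact_le_soft.1 h.le
  | soft s hs =>
    obtain ⟨r, hr, hrt, hlim⟩ := exists_seq_strictMono_tendsto' ht
    obtain ⟨n, hn⟩ := h (fun n => soft (r n) (hrt n).1) (soft t ht)
      (fun m n hmn => soft_le_iff.2 (hr.monotone hmn))
      ⟨by rintro _ ⟨n, rfl⟩; exact soft_le_iff.2 (hrt n).2.le,
        fun w hw => soft_le_iff.2 (le_of_tendsto' hlim fun n => soft_le_iff.1 (hw ⟨n, rfl⟩))⟩
      le_rfl
    exact (soft_le_iff.1 hn).trans_lt (hrt n).2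

theorem val_ne_top_of_wayBelow {u v : CuZ} (h : WayBelow u v) : u.val ≠ ⊤ := by
  cases v with
  | compact n => exact ne_top_of_le_ne_top (ENNReal.natCast_ne_top n) (val_mono h.le)
  | soft t ht => exact (val_lt_of_wayBelow_soft h).ne_top

theorem wayBelow_add_aux {u' u v' v : CuZ} (h : WayBelow u' u) (h' : WayBelow v' v) :
    WayBelow (u' + v') (u + v) := by
  have hlt : u'.val + v'.val < u.val + v.val → WayBelow (u' + v') (u + v) := fun hh =>
    wayBelow_of_lt (not_le.1 fun hle => absurd (val_mono hle)
      (not_le.2 (by rwa [val_add, val_add])))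
  cases u with
  | soft t ht =>
    exact hlt (ENNReal.add_lt_add_of_lt_of_le (val_ne_top_of_wayBelow h')
      (val_lt_of_wayBelow_soft h) (val_mono h'.le))
  | compact m =>
    cases v with
    | soft t ht =>
      exact hlt (ENNReal.add_lt_add_of_le_of_lt (val_ne_top_of_wayBelow h)
        (val_mono h.le) (val_lt_of_wayBelow_soft h'))
    | compact n =>
      refine WayBelow.le_trans ?_ (wayBelow_compact (m + n))
      refine (add_le_add_aux v' h.le).trans ?_
      rw [add_comm, ← compact_add_compact, add_comm (compact m)]
      exact add_le_add_aux _ h'.le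

theorem exists_isLUB_aux (x : ℕ → CuZ) : ∃ w, IsLUB (Set.range x) w := by
  by_cases hmax : ∃ N, ∀ n, x n ≤ x N
  · obtain ⟨N, hN⟩ := hmax
    exact ⟨x N, by rintro _ ⟨n, rfl⟩; exact hN n, fun w hw => hw ⟨N, rfl⟩⟩
  · push Not at hmax
    have hpos : 0 < ⨆ k, (x k).val := by
      obtain ⟨n, hn⟩ := hmax 0
      refine lt_of_lt_of_le ?_ (le_iSup (fun k => (x k).val) n)
      refine pos_iff_ne_zero.2 fun h0 => absurd hn (not_lt.2 ?_)
      cases hxn : x n with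
      | soft t ht => rw [hxn] at h0; exact absurd h0 ht.ne'
      | compact m =>
        rw [hxn] at h0
        obtain rfl : m = 0 := by simpa using h0
        cases x 0 with
        | compact j => exact compact_le_compact.2 (Nat.zero_le j)
        | soft t ht => exact compact_le_soft.2 (by simpa using ht)
    refine ⟨soft _ hpos, ?_, fun w hw => soft_le_iff.2
      (iSup_le fun n => val_mono (hw ⟨n, rfl⟩))⟩
    rintro _ ⟨n, rfl⟩
    cases hxn : x n with
    | soft t ht =>
      refine soft_le_iff.2 ?_
      have := le_iSup (fun k => (x k).val) n
      rwa [hxn] at this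
    | compact m =>
      obtain ⟨k, hk⟩ := hmax n
      refine compact_le_soft.2 (lt_of_lt_of_le ?_ (le_iSup (fun k => (x k).val) k))
      rw [hxn] at hk
      cases hxk : x k with
      | soft t ht => rw [hxk] at hk; exact compact_le_soft.1 hk.le
      | compact j =>
        rw [hxk] at hk
        refine Nat.cast_lt.2 (not_le.1 fun hj => absurd hk (not_lt.2 ?_))
        exact compact_le_compact.2 hj

theorem val_isLUB {x : ℕ → CuZ} {w : CuZ} (h : IsLUB (Set.range x) w) :
    w.val = ⨆ n, (x n).val := by
  refine le_antisymm (le_of_not_gt fun hlt => ?_) (iSup_le fun n => val_mono (h.1 ⟨n, rfl⟩))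
  obtain ⟨r, hr, hrw⟩ := exists_between hlt
  have hle : w ≤ soft r (pos_of_gt hr) := by
    refine h.2 ?_
    rintro _ ⟨n, rfl⟩
    exact le_of_val_lt ((le_iSup (fun n => (x n).val) n).trans_lt hr)
  exact absurd (val_mono hle) (not_le.2 hrw)

instance : CuSemigroup CuZ where
  add_le_add_left u v h w := add_le_add_aux w h
  zero_le' u := by
    cases u with
    | compact n => exact compact_le_compact.2 (Nat.zero_le n)
    | soft t ht => exact compact_le_soft.2 (by simpa using ht)
  exists_isLUB x _ := exists_isLUB_aux x
  exists_wayBelow_seq := exists_wayBelow_seq_aux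
  wayBelow_add := wayBelow_add_aux
  isLUB_add {x y a b} hx hy ha hb := by
    have hadd : ∀ {u u' v v' : CuZ}, u ≤ u' → v ≤ v' → u + v ≤ u' + v' := by
      intro u u' v v' h h'
      refine (add_le_add_aux v h).trans ?_
      rw [add_comm u', add_comm u']
      exact add_le_add_aux u' h'
    refine ⟨?_, fun w hw => ?_⟩
    · rintro _ ⟨n, rfl⟩
      exact hadd (ha.1 ⟨n, rfl⟩) (hb.1 ⟨n, rfl⟩)
    · cases hab : a + b with
      | soft t ht =>
        have ht' : t = (a + b).val := by rw [hab]; rfl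
        refine soft_le_iff.2 ?_
        rw [ht', val_add, val_isLUB ha, val_isLUB hb,
          ENNReal.iSup_add_iSup_of_monotone (fun _ _ h => val_mono (hx h))
            (fun _ _ h => val_mono (hy h))]
        refine iSup_le fun n => ?_
        rw [← val_add]
        exact val_mono (hw ⟨n, rfl⟩)
      | compact k =>
        obtain ⟨⟨m, rfl⟩, ⟨n, rfl⟩⟩ := add_isCompact.1 ⟨k, hab⟩
        rw [← hab]
        obtain ⟨i, hi⟩ := wayBelow_compact m x _ hx ha le_rfl
        obtain ⟨j, hj⟩ := wayBelow_compact n y _ hy hb le_rfl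
        exact (hadd (hi.trans (hx (le_max_left i j))) (hj.trans (hy (le_max_right i j)))).trans
          (hw ⟨max i j, rfl⟩)

end CuZ

end Cu

/-! The wanted map sends x ⊗ u to "φ₂(u · φ₁(x))", although S₂ need not contain fractional multiples
of φ₁(x). An element z of S₂ counts as lying below (a/b)φ₁(x') when bz ≤ aφ₁(x'). The value B(x,u),
called `fracMul`, is the supremum of φ₂(z) over all such z with x' ≪ x and a/b dominated by u. For
soft u = t this means a/b < t. For compact u = n only the denominator 1 is allowed: from bz ≤
bnφ₁(x') almost unperforation cannot cancel b, since there is no strict gap.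

Almost divisibility of φ₁ supplies enough elements z: after an arbitrarily small enlargement of a
fraction p/q there is a w that serves as (p/q)φ₁(x') (`exists_isFracBelow`). Almost unperforation of
φ₂ turns comparisons of multiples with a strict gap into inequalities in T
(`IsAlmostUnperforated.map_le_of_nsmul_le`). Together they show that the sets of values φ₂(z) are
countably directed, so that B is well defined, and that B is biadditive and monotone
(`isMonotoneBiadditive_fracMul`).

Any monotone biadditive B extends to formal sums, and then to ideals by taking suprema. Suprema of
increasing sequences of ideals are unions, so the extension is a generalized Cu-morphism even if B
itself is not known to preserve suprema. It preserves ≪ as soon as B does so jointly, which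
`fracMul_wayBelow` provides for Cu-morphisms. Since 1 is compact in Z, its value at x ⊗ 1 is
φ₂(φ₁(x)). -/

namespace Cu

open scoped NNReal

/-! ### Suprema of countably directed sets, and `≪` under sums and multiples -/

section CountablyDirected

variable {T : Type*} [AddCommMonoid T] [PartialOrder T]

/-- A set containing an increasing sequence that is cofinal in it. -/
def IsCountablyDirected (A : Set T) : Prop :=
  ∃ s : ℕ → T, Monotone s ∧ (∀ n, s n ∈ A) ∧ ∀ x ∈ A, ∃ n, x ≤ s n

/-- Taking x and y among the values of `f`, the hypothesis `h` gives directedness; taking x = y, it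
gives cofinality. An enumeration of the index type then yields the sequence. -/
theorem IsCountablyDirected.of_countable {ι : Type*} [Countable ι] [Nonempty ι] {A : Set T}
    (f : ι → T) (hf : ∀ i, f i ∈ A) (h : ∀ x ∈ A, ∀ y ∈ A, ∃ i, x ≤ f i ∧ y ≤ f i) :
    IsCountablyDirected A := by
  classical
  have := Encodable.ofCountable ι
  have : Inhabited ι := Classical.inhabited_of_nonempty inferInstance
  have hd : Directed (· ≤ ·) f := fun i j => h _ (hf i) _ (hf j)
  refine ⟨fun n => f (hd.sequence f n), hd.sequence_mono, fun n => hf _, fun x hx => ?_⟩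
  obtain ⟨i, hi, -⟩ := h x hx x hx
  exact ⟨_, hi.trans (hd.le_sequence i)⟩

theorem isLUB_range_of_cofinal {A : Set T} {s : ℕ → T} (hs : ∀ n, s n ∈ A)
    (h : ∀ x ∈ A, ∃ n, x ≤ s n) {w : T} : IsLUB A w ↔ IsLUB (Set.range s) w := by
  have : upperBounds A = upperBounds (Set.range s) := by
    ext w
    refine ⟨?_, fun hw x hx => ?_⟩
    · rintro hw _ ⟨n, rfl⟩
      exact hw (hs n)
    · obtain ⟨n, hn⟩ := h x hx
      exact hn.trans (hw ⟨n, rfl⟩)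
  rw [IsLUB, IsLUB, this]

open Classical in
/-- The supremum of a set, with junk value `0` if there is none. -/
noncomputable def supremum (A : Set T) : T :=
  if h : ∃ w, IsLUB A w then h.choose else 0

variable [CuSemigroup T]

theorem IsCountablyDirected.isLUB {A : Set T} (hA : IsCountablyDirected A) :
    IsLUB A (supremum A) := by
  obtain ⟨s, hs, hsA, hcof⟩ := hA
  have h : ∃ w, IsLUB A w := by
    obtain ⟨w, hw⟩ := CuSemigroup.exists_isLUB s hs
    exact ⟨w, (isLUB_range_of_cofinal hsA hcof).2 hw⟩
  rw [supremum, dif_pos h]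
  exact h.choose_spec

/-- This is (O4) along the two cofinal sequences. It yields superadditivity of every map defined by
a supremum below. -/
theorem IsCountablyDirected.add_le {A B : Set T} (hA : IsCountablyDirected A)
    (hB : IsCountablyDirected B) {a b c : T} (ha : IsLUB A a) (hb : IsLUB B b)
    (h : ∀ x ∈ A, ∀ y ∈ B, x + y ≤ c) : a + b ≤ c := by
  obtain ⟨s, hs, hsA, hscof⟩ := hA
  obtain ⟨t, ht, htB, htcof⟩ := hB
  refine (CuSemigroup.isLUB_add hs ht ((isLUB_range_of_cofinal hsA hscof).1 ha)
    ((isLUB_range_of_cofinal htB htcof).1 hb)).2 ?_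
  rintro _ ⟨n, rfl⟩
  exact h _ (hsA n) _ (htB n)

theorem exists_wayBelow_ge_pair {x y z : T} (hx : WayBelow x z) (hy : WayBelow y z) :
    ∃ w, WayBelow w z ∧ x ≤ w ∧ y ≤ w := by
  obtain ⟨s, hs, hz⟩ := CuSemigroup.exists_wayBelow_seq z
  have hm := wayBelow_seq_monotone hs
  obtain ⟨m, hm1⟩ := hx s z hm hz le_rfl
  obtain ⟨n, hn1⟩ := hy s z hm hz le_rfl
  exact ⟨s (max m n), wayBelow_seq_wayBelow hs hz _, hm1.trans (hm (le_max_left _ _)),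
    hn1.trans (hm (le_max_right _ _))⟩

theorem WayBelow.exists_add {v x y : T} (h : WayBelow v (x + y)) :
    ∃ x' y', WayBelow x' x ∧ WayBelow y' y ∧ v ≤ x' + y' := by
  obtain ⟨s, hs, hx⟩ := CuSemigroup.exists_wayBelow_seq x
  obtain ⟨t, ht, hy⟩ := CuSemigroup.exists_wayBelow_seq y
  have hs' := wayBelow_seq_monotone hs
  have ht' := wayBelow_seq_monotone ht
  obtain ⟨n, hn⟩ := h _ _ (fun m n hmn => add_le_add (hs' hmn) (ht' hmn))
    (CuSemigroup.isLUB_add hs' ht' hx hy) le_rfl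
  exact ⟨_, _, wayBelow_seq_wayBelow hs hx n, wayBelow_seq_wayBelow ht hy n, hn⟩

theorem wayBelow_zero : WayBelow (0 : T) 0 :=
  fun _ _ _ _ _ => ⟨0, CuSemigroup.zero_le' _⟩

theorem WayBelow.nsmul {x y : T} (h : WayBelow x y) (n : ℕ) : WayBelow (n • x) (n • y) := by
  induction n with
  | zero => simpa using wayBelow_zero
  | succ n ih => simpa only [succ_nsmul] using CuSemigroup.wayBelow_add ih h

theorem isLUB_nsmul {s : ℕ → T} {x : T} (hs : Monotone s) (hx : IsLUB (Set.range s) x) (n : ℕ) :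
    IsLUB (Set.range fun k => n • s k) (n • x) := by
  induction n with
  | zero => simp
  | succ n ih =>
    simpa only [succ_nsmul] using
      CuSemigroup.isLUB_add (fun i j h => nsmul_le_nsmul_right (hs h) n) hs ih hx

end CountablyDirected

/-! ### Extending monotone biadditive maps to the tensor product -/

section Extension

variable {S Z T : Type*} [AddCommMonoid S] [PartialOrder S] [AddCommMonoid Z] [PartialOrder Z]
  [AddCommMonoid T] [PartialOrder T] [CuSemigroup T]

/-- A biadditive map that is monotone in each variable. -/
structure IsMonotoneBiadditive (B : S → Z → T) : Prop where
  zero_left : ∀ u, B 0 u = 0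
  zero_right : ∀ x, B x 0 = 0
  add_left : ∀ x y u, B (x + y) u = B x u + B y u
  add_right : ∀ x u v, B x (u + v) = B x u + B x v
  mono : ∀ {x y u v}, x ≤ y → u ≤ v → B x u ≤ B y v

/-- The value of a map of two variables at a formal sum of pure tensors. -/
def evalSum (B : S → Z → T) (f : Multiset (S × Z)) : T :=
  (f.map fun p => B p.1 p.2).sum

@[simp] theorem evalSum_zero (B : S → Z → T) : evalSum B 0 = 0 := by simp [evalSum]

@[simp] theorem evalSum_singleton (B : S → Z → T) (x : S) (u : Z) :
    evalSum B {(x, u)} = B x u := by simp [evalSum]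

@[simp] theorem evalSum_add (B : S → Z → T) (f g : Multiset (S × Z)) :
    evalSum B (f + g) = evalSum B f + evalSum B g := by simp [evalSum]

/-- Each generator of the tensor preorder is one of the properties of `B`, so evaluation descends to
the algebraic tensor product. -/
theorem IsMonotoneBiadditive.evalSum_le {B : S → Z → T} (hB : IsMonotoneBiadditive B)
    {f g : Multiset (S × Z)} (h : TensorLE f g) : evalSum B f ≤ evalSum B g := by
  induction h with
  | refl f => exact le_rfl
  | trans _ _ h1 h2 => exact h1.trans h2
  | add _ _ h1 h2 => simpa using add_le_add h1 h2
  | mono h1 h2 => simpa using hB.mono h1 h2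
  | add_left_le a a' b => simp only [evalSum_add, evalSum_singleton, hB.add_left, le_refl]
  | le_add_left a a' b => simp only [evalSum_add, evalSum_singleton, hB.add_left, le_refl]
  | add_right_le a b b' => simp only [evalSum_add, evalSum_singleton, hB.add_right, le_refl]
  | le_add_right a b b' => simp only [evalSum_add, evalSum_singleton, hB.add_right, le_refl]
  | zero_left_le b => simp [hB.zero_left]
  | le_zero_left b => simp [hB.zero_left]
  | zero_right_le a => simp [hB.zero_right]
  | le_zero_right a => simp [hB.zero_right]

theorem IsMonotoneBiadditive.evalSum_wayBelow {B : S → Z → T} (hB : IsMonotoneBiadditive B)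
    (hB' : ∀ {x' x u' u}, WayBelow x' x → WayBelow u' u → WayBelow (B x' u') (B x u))
    {f g : Multiset (S × Z)} (h : TensorPrec f g) : WayBelow (evalSum B f) (evalSum B g) := by
  obtain ⟨f', g', h1, h2, h3⟩ := h
  refine WayBelow.le_trans (hB.evalSum_le h1) (WayBelow.trans_le ?_ (hB.evalSum_le h3))
  clear h1 h3
  induction h2 with
  | zero => simpa using wayBelow_zero
  | cons h _ ih =>
    simp only [← Multiset.singleton_add, evalSum_add]
    refine CuSemigroup.wayBelow_add ?_ ih
    simpa [evalSum] using hB' h.1 h.2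

variable [CuSemigroup S] [CuSemigroup Z]

/-- The extension of a map of two variables to the tensor product. -/
noncomputable def extension (B : S → Z → T) (I : CuTensor S Z) : T :=
  supremum (evalSum B '' I.1)

variable {B : S → Z → T}

theorem IsMonotoneBiadditive.isCountablyDirected_image (hB : IsMonotoneBiadditive B)
    (I : CuTensor S Z) : IsCountablyDirected (evalSum B '' I.1) := by
  obtain ⟨s, hs, hsI, hcof⟩ := I.exists_seq
  refine ⟨fun n => evalSum B (s n), fun m n h => hB.evalSum_le (prec_seq_mono hs h),
    fun n => ⟨_, hsI n, rfl⟩, ?_⟩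
  rintro _ ⟨f, hf, rfl⟩
  obtain ⟨n, hn⟩ := hcof f hf
  exact ⟨n, hB.evalSum_le hn.le⟩

theorem IsMonotoneBiadditive.isLUB_extension (hB : IsMonotoneBiadditive B) (I : CuTensor S Z) :
    IsLUB (evalSum B '' I.1) (extension B I) :=
  (hB.isCountablyDirected_image I).isLUB

theorem IsMonotoneBiadditive.le_extension (hB : IsMonotoneBiadditive B) {I : CuTensor S Z}
    {f : Multiset (S × Z)} (hf : f ∈ I.1) : evalSum B f ≤ extension B I :=
  (hB.isLUB_extension I).1 ⟨f, hf, rfl⟩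

theorem IsMonotoneBiadditive.extension_le (hB : IsMonotoneBiadditive B) {I : CuTensor S Z} {w : T}
    (h : ∀ f ∈ I.1, evalSum B f ≤ w) : extension B I ≤ w :=
  (hB.isLUB_extension I).2 (by rintro _ ⟨f, hf, rfl⟩; exact h f hf)

/-- No continuity of `B` is needed: a formal sum in the supremum of an increasing sequence of ideals
already lies in one of them. -/
theorem IsMonotoneBiadditive.isGeneralizedCuMorphism_extension (hB : IsMonotoneBiadditive B) :
    IsGeneralizedCuMorphism (extension B) where
  map_zero := le_antisymm
    (hB.extension_le fun f hf => by simpa using hB.evalSum_le (CuTensor.mem_zero.1 hf))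
    (CuSemigroup.zero_le' _)
  map_add I J := by
    refine le_antisymm (hB.extension_le ?_) ?_
    · rintro h ⟨f, hf, g, hg, hh⟩
      refine (hB.evalSum_le hh).trans ?_
      rw [evalSum_add]
      exact add_le_add (hB.le_extension hf) (hB.le_extension hg)
    · refine (hB.isCountablyDirected_image I).add_le (hB.isCountablyDirected_image J)
        (hB.isLUB_extension I) (hB.isLUB_extension J) ?_
      rintro _ ⟨f, hf, rfl⟩ _ ⟨g, hg, rfl⟩
      rw [← evalSum_add]
      exact hB.le_extension ⟨f, hf, g, hg, .refl _⟩
  monotone I J h := hB.extension_le fun f hf => hB.le_extension (h hf)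
  map_isLUB I J hI hJ := by
    rw [CuTensor.isLUB_iff hI] at hJ
    refine ⟨?_, fun w hw => hB.extension_le fun f hf => ?_⟩
    · rintro _ ⟨n, rfl⟩
      exact hB.extension_le fun f hf => hB.le_extension ((hJ f).2 ⟨n, hf⟩)
    · obtain ⟨n, hn⟩ := (hJ f).1 hf
      exact (hB.le_extension hn).trans (hw ⟨n, rfl⟩)

theorem IsMonotoneBiadditive.isCuMorphism_extension (hB : IsMonotoneBiadditive B)
    (hB' : ∀ {x' x u' u}, WayBelow x' x → WayBelow u' u → WayBelow (B x' u') (B x u)) :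
    IsCuMorphism (extension B) where
  toIsGeneralizedCuMorphism := hB.isGeneralizedCuMorphism_extension
  map_wayBelow {I J} h := by
    obtain ⟨g, hg, hI⟩ := CuTensor.exists_mem_of_wayBelow h
    -- Roundness of the ideal `J` gives `k` in `J` with `g` ≺ `k`; this is the step that evaluation
    -- turns into `≪`.
    obtain ⟨k, hk, hgk, -⟩ := J.directed hg hg
    exact WayBelow.le_trans (hB.extension_le fun f hf => hB.evalSum_le (hI f hf))
      ((hB.evalSum_wayBelow hB' hgk).trans_le (hB.le_extension hk))

end Extension

/-! ### Fractions dominated by an element of Z -/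

namespace CuZ

/-- The fraction `a / b` is dominated by `u`: as an integer (with `b = 1`) if `u` is compact, and
strictly if `u` is soft. -/
def DominatesFrac : CuZ → ℕ → ℕ → Prop
  | compact n, a, b => b = 1 ∧ a ≤ n
  | soft t _, a, b => 0 < b ∧ ((a / b : ℝ≥0) : ℝ≥0∞) < t

theorem natCast_div_lt_div_iff {a b p q : ℕ} (hb : 0 < b) (hq : 0 < q) :
    (a / b : ℝ≥0) < p / q ↔ a * q < p * b := by
  rw [div_lt_div_iff₀ (by exact_mod_cast hb) (by exact_mod_cast hq)]
  exact_mod_cast Iff.rfl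

theorem exists_natCast_div_between {y t : ℝ≥0∞} (h : y < t) :
    ∃ p q : ℕ, 0 < q ∧ y < ((p / q : ℝ≥0) : ℝ≥0∞) ∧ ((p / q : ℝ≥0) : ℝ≥0∞) < t := by
  obtain ⟨r, hr, h1, h2⟩ := ENNReal.lt_iff_exists_rat_btwn.1 h
  have hr' : Real.toNNReal r = (r.num.toNat / r.den : ℝ≥0) := by
    apply NNReal.coe_injective
    rw [Real.coe_toNNReal _ (by exact_mod_cast hr)]
    push_cast
    have : ((r.num.toNat : ℕ) : ℝ) = (r.num : ℝ) := by
      exact_mod_cast Int.toNat_of_nonneg (Rat.num_nonneg.2 hr)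
    rw [this, Rat.cast_def]
  rw [hr'] at h1 h2
  exact ⟨_, _, r.den_pos, h1, h2⟩

theorem DominatesFrac.pos {u : CuZ} {a b : ℕ} (h : u.DominatesFrac a b) : 0 < b := by
  cases u with
  | compact n => rw [h.1]; exact Nat.one_pos
  | soft t ht => exact h.1

theorem natCast_div_add_div {a b p q : ℕ} (hb : 0 < b) (hq : 0 < q) :
    (a / b : ℝ≥0) + p / q = ((a * q + p * b : ℕ) : ℝ≥0) / ((b * q : ℕ) : ℝ≥0) := by
  have hb' : (b : ℝ≥0) ≠ 0 := by exact_mod_cast hb.ne'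
  have hq' : (q : ℝ≥0) ≠ 0 := by exact_mod_cast hq.ne'
  push_cast
  rw [div_add_div _ _ hb' hq', mul_comm (b : ℝ≥0) p]

theorem DominatesFrac.add {u v : CuZ} {a b p q : ℕ} (h : u.DominatesFrac a b)
    (h' : v.DominatesFrac p q) : (u + v).DominatesFrac (a * q + p * b) (b * q) := by
  have hb := h.pos
  have hq := h'.pos
  cases u with
  | compact m =>
    obtain ⟨rfl, ha⟩ := h
    cases v with
    | compact n =>
      obtain ⟨rfl, hp⟩ := h'
      exact ⟨rfl, by simpa using Nat.add_le_add ha hp⟩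
    | soft t ht =>
      refine ⟨Nat.mul_pos hb hq, ?_⟩
      rw [← natCast_div_add_div hb hq, ENNReal.coe_add]
      refine ENNReal.add_lt_add_of_le_of_lt (by simp) ?_ h'.2
      simpa using ha
  | soft s hs =>
    cases v with
    | compact n =>
      obtain ⟨rfl, hp⟩ := h'
      refine ⟨Nat.mul_pos hb hq, ?_⟩
      rw [← natCast_div_add_div hb hq, ENNReal.coe_add]
      refine ENNReal.add_lt_add_of_lt_of_le (by simp) h.2 ?_
      simpa using hp
    | soft t ht =>
      refine ⟨Nat.mul_pos hb hq, ?_⟩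
      rw [← natCast_div_add_div hb hq, ENNReal.coe_add]
      exact ENNReal.add_lt_add h.2 h'.2

/-- Over the common denominator `b * q` the larger numerator gives one of the two original
fractions. For compact `u` both denominators are 1, and so is their product. -/
theorem DominatesFrac.exists_common {u : CuZ} {a b p q : ℕ} (h : u.DominatesFrac a b)
    (h' : u.DominatesFrac p q) :
    ∃ r, u.DominatesFrac r (b * q) ∧ a * q ≤ r ∧ p * b ≤ r := by
  refine ⟨max (a * q) (p * b), ?_, le_max_left _ _, le_max_right _ _⟩
  cases u with
  | compact n =>
    obtain ⟨rfl, ha⟩ := h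
    obtain ⟨rfl, hp⟩ := h'
    exact ⟨rfl, by simpa using ⟨ha, hp⟩⟩
  | soft t ht =>
    refine ⟨Nat.mul_pos h.1 h'.1, ?_⟩
    have hb : (b : ℝ≥0) ≠ 0 := by exact_mod_cast h.1.ne'
    have hq : (q : ℝ≥0) ≠ 0 := by exact_mod_cast h'.1.ne'
    rcases le_total (a * q) (p * b) with hle | hle
    · rw [max_eq_right hle, mul_comm b q]
      push_cast
      rw [mul_div_mul_right _ _ hb]
      exact h'.2
    · rw [max_eq_left hle]
      push_cast
      rw [mul_div_mul_right _ _ hq]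
      exact h.2

/-- The strict inequality at soft elements leaves room for a larger fraction; this room absorbs the
errors of almost divisibility and almost unperforation. -/
theorem DominatesFrac.exists_gt {t : ℝ≥0∞} {ht : 0 < t} {a b : ℕ}
    (h : (soft t ht).DominatesFrac a b) :
    ∃ p q, (soft t ht).DominatesFrac p q ∧ a * q < p * b := by
  obtain ⟨p, q, hq, h1, h2⟩ := exists_natCast_div_between h.2
  exact ⟨p, q, ⟨hq, h2⟩, (natCast_div_lt_div_iff h.1 hq).1 (ENNReal.coe_lt_coe.1 h1)⟩

theorem DominatesFrac.mul_lt {t : ℝ≥0∞} {ht : 0 < t} {a b n : ℕ}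
    (h : (soft t ht).DominatesFrac a b) (htn : t ≤ n) : a < n * b := by
  have := h.2.trans_le htn
  have h1 : (a / b : ℝ≥0) < (n : ℕ) / (1 : ℕ) := by
    rw [Nat.cast_one, div_one]
    exact_mod_cast this
  simpa using (natCast_div_lt_div_iff h.1 Nat.one_pos).1 h1

theorem DominatesFrac.exists_split_compact {t : ℝ≥0∞} {ht : 0 < t} {n a b : ℕ}
    (h : (compact n + soft t ht).DominatesFrac a b) :
    ∃ p q, (soft t ht).DominatesFrac p q ∧ a * q < (n * q + p) * b := by
  obtain ⟨hb, h⟩ := h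
  -- Subtraction is truncated: if a/b ≤ n the difference is 0, and any fraction in (0, t) will do.
  have h' : ((a / b : ℝ≥0) : ℝ≥0∞) - n < t := by
    rcases le_total ((a / b : ℝ≥0) : ℝ≥0∞) n with hle | hle
    · rwa [tsub_eq_zero_of_le hle]
    · exact ENNReal.sub_lt_of_lt_add hle (by rwa [add_comm])
  obtain ⟨p, q, hq, h1, h2⟩ := exists_natCast_div_between h'
  refine ⟨p, q, ⟨hq, h2⟩, ?_⟩
  have h3 : ((a / b : ℝ≥0) : ℝ≥0∞) < n + ((p / q : ℝ≥0) : ℝ≥0∞) :=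
    not_le.1 fun hle =>
      absurd (ENNReal.le_sub_of_add_le_left (ENNReal.natCast_ne_top n) hle) (not_le.2 h1)
  have h4 : (a / b : ℝ≥0) < n / (1 : ℕ) + p / q := by
    rw [Nat.cast_one, div_one]
    exact_mod_cast h3
  rw [natCast_div_add_div Nat.one_pos hq, natCast_div_lt_div_iff hb (by simpa using hq)] at h4
  simpa using h4

/-- If a summand is soft, a/b is strictly below the sum of two dominated fractions. Two compact
summands leave no such gap and are set apart. -/
theorem DominatesFrac.exists_split {u v : CuZ} {a b : ℕ} (h : (u + v).DominatesFrac a b) :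
    (∃ m n, u = compact m ∧ v = compact n) ∨ ∃ p q p' q', u.DominatesFrac p q ∧
      v.DominatesFrac p' q' ∧ a * (q * q') < (p * q' + p' * q) * b := by
  cases u with
  | compact m =>
    cases v with
    | compact n => exact .inl ⟨m, n, rfl, rfl⟩
    | soft t ht =>
      obtain ⟨p, q, hpq, hlt⟩ := h.exists_split_compact
      exact .inr ⟨m, 1, p, q, ⟨rfl, le_rfl⟩, hpq, by simpa using hlt⟩
  | soft s hs =>
    refine .inr ?_
    cases v with
    | compact n =>
      rw [add_comm] at h
      obtain ⟨p, q, hpq, hlt⟩ := h.exists_split_compact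
      exact ⟨p, q, n, 1, hpq, ⟨rfl, le_rfl⟩, by simpa [add_comm] using hlt⟩
    | soft t ht =>
      obtain ⟨s', hs', t', ht', hlt⟩ := ENNReal.exists_lt_add_of_lt_add h.2 hs.ne' ht.ne'
      obtain ⟨p, q, hq, h1, h2⟩ := exists_natCast_div_between hs'
      obtain ⟨p', q', hq', h1', h2'⟩ := exists_natCast_div_between ht'
      refine ⟨p, q, p', q', ⟨hq, h2⟩, ⟨hq', h2'⟩, ?_⟩
      have h3 := hlt.trans (ENNReal.add_lt_add h1 h1')
      rw [← ENNReal.coe_add, ENNReal.coe_lt_coe, natCast_div_add_div hq hq',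
        natCast_div_lt_div_iff h.1 (Nat.mul_pos hq hq')] at h3
      exact h3

end CuZ

theorem CuZ.DominatesFrac.le_val {u : CuZ} {a b : ℕ} (h : u.DominatesFrac a b) :
    ((a / b : ℝ≥0) : ℝ≥0∞) ≤ u.val := by
  cases u with
  | compact n =>
    obtain ⟨rfl, ha⟩ := h
    simpa using ha
  | soft t ht => exact h.2.le

theorem CuZ.dominatesFrac_zero_one (u : CuZ) : u.DominatesFrac 0 1 := by
  cases u with
  | compact n => exact ⟨rfl, Nat.zero_le n⟩
  | soft t ht => exact ⟨Nat.one_pos, by simpa using ht⟩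

/-! ### Comparing integer multiples -/

section Nsmul

variable {S : Type*} [AddCommMonoid S] [PartialOrder S] [CuSemigroup S]

theorem nsmul_mono {m n : ℕ} {x y : S} (h : m ≤ n) (hxy : x ≤ y) : m • x ≤ n • y :=
  (nsmul_le_nsmul_right hxy m).trans (nsmul_le_nsmul_left (CuSemigroup.zero_le' y) h)

theorem WayBelow.exists_nsmul {v w : S} {n : ℕ} (h : WayBelow v (n • w)) :
    ∃ w', WayBelow w' w ∧ v ≤ n • w' := by
  obtain ⟨s, hs, hw⟩ := CuSemigroup.exists_wayBelow_seq w
  have hs' := wayBelow_seq_monotone hs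
  obtain ⟨k, hk⟩ := h _ _ (fun i j hij => nsmul_le_nsmul_right (hs' hij) n)
    (isLUB_nsmul hs' hw n) le_rfl
  exact ⟨_, wayBelow_seq_wayBelow hs hw k, hk⟩

theorem IsGeneralizedCuMorphism.map_nsmul {T : Type*} [AddCommMonoid T] [PartialOrder T]
    [CuSemigroup T] {φ : S → T} (h : IsGeneralizedCuMorphism φ) (n : ℕ) (x : S) :
    φ (n • x) = n • φ x := by
  induction n with
  | zero => simpa using h.map_zero
  | succ n ih => rw [succ_nsmul, succ_nsmul, h.map_add, ih]

/-- Formally x ≤ (a/b)z and z ≤ (c/d)y with (ac)/(bd) < 1. Clearing denominators gives (ca + 1)x ≤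
(ca)y. -/
theorem IsAlmostUnperforated.map_le_of_nsmul_le {T : Type*} [PartialOrder T] {φ : S → T}
    (h : IsAlmostUnperforated φ) {a b c d : ℕ} {x y z : S} (h1 : b • x ≤ a • z)
    (h2 : d • z ≤ c • y) (hlt : c * a < d * b) : φ x ≤ φ y := by
  refine h (c * a) x y ?_
  calc (c * a + 1) • x ≤ (d * b) • x := nsmul_mono hlt le_rfl
    _ = d • b • x := mul_smul _ _ _
    _ ≤ d • a • z := nsmul_le_nsmul_right h1 d
    _ = a • d • z := smul_comm _ _ _
    _ ≤ a • c • y := nsmul_le_nsmul_right h2 a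
    _ = (c * a) • y := by rw [smul_comm, mul_smul]

end Nsmul

/-! ### Fractional multiples of φ₁(x) and their images under φ₂ -/

variable {S₁ S₂ T : Type*}
  [AddCommMonoid S₁] [PartialOrder S₁] [CuSemigroup S₁]
  [AddCommMonoid S₂] [PartialOrder S₂] [CuSemigroup S₂]
  [AddCommMonoid T] [PartialOrder T] [CuSemigroup T]

/-- `z` lies below the fictitious multiple `u • φ x` of `φ x`, witnessed by a fraction dominated
by `u`. -/
def IsFracBelow (φ : S₁ → S₂) (x : S₁) (u : CuZ) (z : S₂) : Prop :=
  ∃ x', WayBelow x' x ∧ ∃ a b, u.DominatesFrac a b ∧ b • z ≤ a • φ x'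

/-- The image under `φ₂` of the fictitious multiple `u • φ₁ x`. -/
noncomputable def fracMul (φ₁ : S₁ → S₂) (φ₂ : S₂ → T) (x : S₁) (u : CuZ) : T :=
  supremum (φ₂ '' {z | IsFracBelow φ₁ x u z})

section

variable {φ₁ : S₁ → S₂} {φ₂ : S₂ → T}

theorem IsFracBelow.add_left (hφ₁ : IsGeneralizedCuMorphism φ₁) {x y : S₁} {u : CuZ} {z w : S₂}
    (hz : IsFracBelow φ₁ x u z) (hw : IsFracBelow φ₁ y u w) :
    IsFracBelow φ₁ (x + y) u (z + w) := by
  obtain ⟨x', hx, a, b, hab, hz⟩ := hz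
  obtain ⟨y', hy, p, q, hpq, hw⟩ := hw
  obtain ⟨r, hr, h1, h2⟩ := hab.exists_common hpq
  refine ⟨x' + y', CuSemigroup.wayBelow_add hx hy, r, b * q, hr, ?_⟩
  rw [hφ₁.map_add, smul_add, smul_add]
  refine add_le_add ?_ ?_
  · calc (b * q) • z = q • b • z := by rw [mul_comm, mul_smul]
      _ ≤ q • a • φ₁ x' := nsmul_le_nsmul_right hz q
      _ = (a * q) • φ₁ x' := by rw [mul_comm, mul_smul]
      _ ≤ r • φ₁ x' := nsmul_mono h1 le_rfl
  · calc (b * q) • w = b • q • w := by rw [mul_smul]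
      _ ≤ b • p • φ₁ y' := nsmul_le_nsmul_right hw b
      _ = (p * b) • φ₁ y' := by rw [mul_comm, mul_smul]
      _ ≤ r • φ₁ y' := nsmul_mono h2 le_rfl

theorem IsFracBelow.add_right (hφ₁ : IsGeneralizedCuMorphism φ₁) {x : S₁} {u v : CuZ} {z w : S₂}
    (hz : IsFracBelow φ₁ x u z) (hw : IsFracBelow φ₁ x v w) :
    IsFracBelow φ₁ x (u + v) (z + w) := by
  obtain ⟨x', hx, a, b, hab, hz⟩ := hz
  obtain ⟨y', hy, p, q, hpq, hw⟩ := hw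
  obtain ⟨v, hv, hxv, hyv⟩ := exists_wayBelow_ge_pair hx hy
  refine ⟨v, hv, a * q + p * b, b * q, hab.add hpq, ?_⟩
  rw [smul_add, add_smul]
  refine add_le_add ?_ ?_
  · calc (b * q) • z = q • b • z := by rw [mul_comm, mul_smul]
      _ ≤ q • a • φ₁ v :=
        nsmul_le_nsmul_right (hz.trans (nsmul_le_nsmul_right (hφ₁.monotone hxv) a)) q
      _ = (a * q) • φ₁ v := by rw [mul_comm, mul_smul]
  · calc (b * q) • w = b • q • w := by rw [mul_smul]
      _ ≤ b • p • φ₁ v :=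
        nsmul_le_nsmul_right (hw.trans (nsmul_le_nsmul_right (hφ₁.monotone hyv) p)) b
      _ = (p * b) • φ₁ v := by rw [mul_comm, mul_smul]

theorem isFracBelow_nsmul {x' x : S₁} (h : WayBelow x' x) {m n : ℕ} (hmn : m ≤ n) :
    IsFracBelow φ₁ x (.compact n) (m • φ₁ x') :=
  ⟨x', h, m, 1, ⟨rfl, hmn⟩, by rw [one_smul]⟩

/-- The element `w` plays the role of (p/q)φ₁(x'): it is still admissible for `u`, yet dominates
(p/q)φ₁(x') after multiplication by `c * q`, and dominates in T every z below that multiple. For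
compact `u` it is the honest multiple pφ₁(x'). -/
theorem exists_isFracBelow (hdiv : IsAlmostDivisible φ₁) (hunp : IsAlmostUnperforated φ₂)
    (hφ₂ : Monotone φ₂) {x' x : S₁} (hx : WayBelow x' x) {u : CuZ} {p q : ℕ}
    (hpq : u.DominatesFrac p q) :
    ∃ w, IsFracBelow φ₁ x u w ∧ (∃ c, 0 < c ∧ (c * p) • φ₁ x' ≤ (c * q) • w) ∧
      ∀ z, q • z ≤ p • φ₁ x' → φ₂ z ≤ φ₂ w := by
  cases u with
  | compact n =>
    obtain ⟨rfl, hp⟩ := hpq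
    exact ⟨p • φ₁ x', isFracBelow_nsmul hx hp, ⟨1, Nat.one_pos, by simp⟩,
      fun z hz => hφ₂ (by rwa [one_smul] at hz)⟩
  | soft t ht =>
    obtain ⟨y, hxy, hy⟩ := hx.interpolate
    obtain ⟨a, b, hab, hlt⟩ := hpq.exists_gt
    -- With k = b(p+1), the element a(p+1)w is at most (a/b)φ₁(y), since kw ≤ φ₁(y). The factor p+1
    -- makes k large enough: aq ≥ pb + 1 gives a(p+1)q ≥ pk + p + 1 > (k+1)p, so passing from k to
    -- k+1 does not use up the gap between p/q and a/b.
    obtain ⟨w, hw1, hw2⟩ := hdiv (b * (p + 1)) x' y hxy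
    have hlt' : (b * (p + 1) + 1) * p < (a * (p + 1)) * q := by nlinarith
    refine ⟨(a * (p + 1)) • w, ⟨y, hy, a, b, hab, ?_⟩, ⟨b * (p + 1) + 1, Nat.succ_pos _, ?_⟩,
      fun z hz => hunp.map_le_of_nsmul_le (c := b * (p + 1) + 1) (d := a * (p + 1)) hz ?_ hlt'⟩
    · calc b • (a * (p + 1)) • w = a • (b * (p + 1)) • w := by
            rw [smul_smul, smul_smul]; congr 1; ring
        _ ≤ a • φ₁ y := nsmul_le_nsmul_right hw1 a
    · calc ((b * (p + 1) + 1) * p) • φ₁ x'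
            ≤ ((b * (p + 1) + 1) * p) • (b * (p + 1) + 1) • w := nsmul_le_nsmul_right hw2 _
        _ = (((b * (p + 1) + 1) * p) * (b * (p + 1) + 1)) • w := (mul_smul _ _ _).symm
        _ ≤ (((a * (p + 1)) * q) * (b * (p + 1) + 1)) • w :=
            nsmul_mono (Nat.mul_le_mul_right _ hlt'.le) le_rfl
        _ = ((b * (p + 1) + 1) * q) • (a * (p + 1)) • w := by
            rw [smul_smul]; congr 1; ring
    · calc (a * (p + 1)) • φ₁ x' ≤ (a * (p + 1)) • (b * (p + 1) + 1) • w :=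
            nsmul_le_nsmul_right hw2 _
        _ = (b * (p + 1) + 1) • (a * (p + 1)) • w := smul_comm _ _ _

/-- Any two admissible elements are bounded over a common x' and a common fraction, and
`exists_isFracBelow` dominates both in T. Terms of one `≪`-increasing sequence for x together with
pairs of naturals suffice, so the index set is countable. -/
theorem isCountablyDirected_fracBelow (hφ₁ : Monotone φ₁) (hφ₂ : Monotone φ₂)
    (hdiv : IsAlmostDivisible φ₁) (hunp : IsAlmostUnperforated φ₂) (x : S₁) (u : CuZ) :
    IsCountablyDirected (φ₂ '' {z | IsFracBelow φ₁ x u z}) := by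
  obtain ⟨s, hs, hx⟩ := CuSemigroup.exists_wayBelow_seq x
  have hs' := wayBelow_seq_monotone hs
  choose w hw _ hw' using fun i : {i : ℕ × ℕ × ℕ // u.DominatesFrac i.2.1 i.2.2} =>
    exists_isFracBelow hdiv hunp hφ₂ (wayBelow_seq_wayBelow hs hx i.1.1) i.2
  have : Nonempty {i : ℕ × ℕ × ℕ // u.DominatesFrac i.2.1 i.2.2} :=
    ⟨⟨(0, 0, 1), u.dominatesFrac_zero_one⟩⟩
  refine .of_countable (fun i => φ₂ (w i)) (fun i => ⟨_, hw i, rfl⟩) ?_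
  rintro _ ⟨z, ⟨x', hx', a, b, hab, hz⟩, rfl⟩ _ ⟨z', ⟨y', hy', p, q, hpq, hz'⟩, rfl⟩
  obtain ⟨m, hm⟩ := hx' s x hs' hx le_rfl
  obtain ⟨n, hn⟩ := hy' s x hs' hx le_rfl
  obtain ⟨r, hr, h1, h2⟩ := hab.exists_common hpq
  refine ⟨⟨(max m n, r, b * q), hr⟩, hw' _ _ ?_, hw' _ _ ?_⟩
  · calc (b * q) • z = q • b • z := by rw [mul_comm, mul_smul]
      _ ≤ q • a • φ₁ x' := nsmul_le_nsmul_right hz q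
      _ = (a * q) • φ₁ x' := by rw [mul_comm, mul_smul]
      _ ≤ r • φ₁ (s (max m n)) := nsmul_mono h1 (hφ₁ (hm.trans (hs' (le_max_left _ _))))
  · calc (b * q) • z' = b • q • z' := by rw [mul_smul]
      _ ≤ b • p • φ₁ y' := nsmul_le_nsmul_right hz' b
      _ = (p * b) • φ₁ y' := by rw [mul_comm, mul_smul]
      _ ≤ r • φ₁ (s (max m n)) := nsmul_mono h2 (hφ₁ (hn.trans (hs' (le_max_right _ _))))

/-- This gives subadditivity in the first variable. For soft `u` the fraction is enlarged, and the
approximate multiples of φ₁(x') and φ₁(y') add up to an element dominating z in T. For compact `u`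
exact integer multiples are used. -/
theorem exists_isFracBelow_add_left (hφ₁ : IsGeneralizedCuMorphism φ₁) (hφ₂ : Monotone φ₂)
    (hdiv : IsAlmostDivisible φ₁) (hunp : IsAlmostUnperforated φ₂) {x y : S₁} {u : CuZ} {z : S₂}
    (h : IsFracBelow φ₁ (x + y) u z) :
    ∃ w w', IsFracBelow φ₁ x u w ∧ IsFracBelow φ₁ y u w' ∧ φ₂ z ≤ φ₂ (w + w') := by
  obtain ⟨v, hv, a, b, hab, hz⟩ := h
  obtain ⟨x', y', hx, hy, hvxy⟩ := hv.exists_add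
  replace hz : b • z ≤ a • (φ₁ x' + φ₁ y') := by
    rw [← hφ₁.map_add]
    exact hz.trans (nsmul_le_nsmul_right (hφ₁.monotone hvxy) a)
  cases u with
  | compact n =>
    obtain ⟨rfl, ha⟩ := hab
    rw [one_smul, smul_add] at hz
    exact ⟨_, _, isFracBelow_nsmul hx ha, isFracBelow_nsmul hy ha, hφ₂ hz⟩
  | soft t ht =>
    obtain ⟨p, q, hpq, hlt⟩ := hab.exists_gt
    obtain ⟨w, hw, ⟨c, hc, hcw⟩, -⟩ := exists_isFracBelow hdiv hunp hφ₂ hx hpq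
    obtain ⟨w', hw', ⟨c', hc', hcw'⟩, -⟩ := exists_isFracBelow hdiv hunp hφ₂ hy hpq
    -- The two bounds hold only after scaling by `c` and `c'`; their product serves both and cancels
    -- from the final strict inequality.
    refine ⟨w, w', hw, hw', hunp.map_le_of_nsmul_le (c := c * c' * q) (d := c * c' * p) hz ?_ ?_⟩
    · rw [smul_add, smul_add]
      refine add_le_add ?_ ?_
      · calc (c * c' * p) • φ₁ x' = c' • (c * p) • φ₁ x' := by
              rw [smul_smul]; congr 1; ring
          _ ≤ c' • (c * q) • w := nsmul_le_nsmul_right hcw c'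
          _ = (c * c' * q) • w := by rw [smul_smul]; congr 1; ring
      · calc (c * c' * p) • φ₁ y' = c • (c' * p) • φ₁ y' := by
              rw [smul_smul]; congr 1; ring
          _ ≤ c • (c' * q) • w' := nsmul_le_nsmul_right hcw' c
          _ = (c * c' * q) • w' := by rw [smul_smul]; congr 1; ring
    · calc c * c' * q * a = c * c' * (a * q) := by ring
        _ < c * c' * (p * b) := Nat.mul_lt_mul_of_pos_left hlt (Nat.mul_pos hc hc')
        _ = c * c' * p * b := by ring

theorem exists_isFracBelow_add_right (hφ₂ : Monotone φ₂)
    (hdiv : IsAlmostDivisible φ₁) (hunp : IsAlmostUnperforated φ₂) {x : S₁} {u v : CuZ} {z : S₂}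
    (h : IsFracBelow φ₁ x (u + v) z) :
    ∃ w w', IsFracBelow φ₁ x u w ∧ IsFracBelow φ₁ x v w' ∧ φ₂ z ≤ φ₂ (w + w') := by
  obtain ⟨x', hx, a, b, hab, hz⟩ := h
  rcases hab.exists_split with ⟨m, n, rfl, rfl⟩ | ⟨p, q, p', q', hpq, hpq', hlt⟩
  · obtain ⟨rfl, ha⟩ := hab
    rw [one_smul] at hz
    refine ⟨_, _, isFracBelow_nsmul hx le_rfl, isFracBelow_nsmul hx le_rfl, hφ₂ (hz.trans ?_)⟩
    rw [← add_smul]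
    exact nsmul_mono ha le_rfl
  · obtain ⟨w, hw, ⟨c, hc, hcw⟩, -⟩ := exists_isFracBelow hdiv hunp hφ₂ hx hpq
    obtain ⟨w', hw', ⟨c', hc', hcw'⟩, -⟩ := exists_isFracBelow hdiv hunp hφ₂ hx hpq'
    refine ⟨w, w', hw, hw', hunp.map_le_of_nsmul_le (c := c * c' * (q * q'))
      (d := c * c' * (p * q') + c * c' * (p' * q)) hz ?_ ?_⟩
    · rw [smul_add, add_smul]
      refine add_le_add ?_ ?_
      · calc (c * c' * (p * q')) • φ₁ x' = (c' * q') • (c * p) • φ₁ x' := by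
              rw [smul_smul]; congr 1; ring
          _ ≤ (c' * q') • (c * q) • w := nsmul_le_nsmul_right hcw _
          _ = (c * c' * (q * q')) • w := by rw [smul_smul]; congr 1; ring
      · calc (c * c' * (p' * q)) • φ₁ x' = (c * q) • (c' * p') • φ₁ x' := by
              rw [smul_smul]; congr 1; ring
          _ ≤ (c * q) • (c' * q') • w' := nsmul_le_nsmul_right hcw' _
          _ = (c * c' * (q * q')) • w' := by rw [smul_smul]; congr 1; ring
    · calc c * c' * (q * q') * a = c * c' * (a * (q * q')) := by ring
        _ < c * c' * ((p * q' + p' * q) * b) :=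
          Nat.mul_lt_mul_of_pos_left hlt (Nat.mul_pos hc hc')
        _ = (c * c' * (p * q') + c * c' * (p' * q)) * b := by ring

/-- Only soft below compact needs a new witness: there a/b < n strictly, and almost unperforation
compares z with nφ₁(x'). -/
theorem IsFracBelow.exists_of_le (hunp : IsAlmostUnperforated φ₂) {x y : S₁} {u v : CuZ}
    (hxy : x ≤ y) (huv : u ≤ v) {z : S₂} (h : IsFracBelow φ₁ x u z) :
    ∃ w, IsFracBelow φ₁ y v w ∧ φ₂ z ≤ φ₂ w := by
  obtain ⟨x', hx, a, b, hab, hz⟩ := h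
  replace hx := hx.trans_le hxy
  cases u with
  | compact m =>
    refine ⟨z, ⟨x', hx, a, b, ?_, hz⟩, le_rfl⟩
    obtain ⟨rfl, ha⟩ := hab
    cases v with
    | compact n => exact ⟨rfl, ha.trans (CuZ.compact_le_compact.1 huv)⟩
    | soft t ht =>
      refine ⟨Nat.one_pos, lt_of_le_of_lt ?_ (CuZ.compact_le_soft.1 huv)⟩
      simpa using ha
  | soft s hs =>
    have hst := CuZ.soft_le_iff.1 huv
    cases v with
    | compact n =>
      refine ⟨n • φ₁ x', isFracBelow_nsmul hx le_rfl,
        hunp.map_le_of_nsmul_le (c := 1) (d := n) hz (by rw [one_smul]) ?_⟩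
      rw [one_mul]
      exact hab.mul_lt hst
    | soft t ht => exact ⟨z, ⟨x', hx, a, b, ⟨hab.1, hab.2.trans_le hst⟩, hz⟩, le_rfl⟩

variable (hφ₁ : IsGeneralizedCuMorphism φ₁) (hφ₂ : IsGeneralizedCuMorphism φ₂)
  (hdiv : IsAlmostDivisible φ₁) (hunp : IsAlmostUnperforated φ₂)

theorem isLUB_fracMul (hφ₁ : Monotone φ₁) (hφ₂ : Monotone φ₂)
    (hdiv : IsAlmostDivisible φ₁) (hunp : IsAlmostUnperforated φ₂) (x : S₁) (u : CuZ) :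
    IsLUB (φ₂ '' {z | IsFracBelow φ₁ x u z}) (fracMul φ₁ φ₂ x u) :=
  (isCountablyDirected_fracBelow hφ₁ hφ₂ hdiv hunp x u).isLUB

include hφ₁ hφ₂ hdiv hunp

/-- Since only denominator 1 occurs, the multiples nφ₁(x') with x' ≪ x are cofinal, and φ₁, φ₂
preserve the supremum over x'. -/
theorem fracMul_compact (x : S₁) (n : ℕ) :
    fracMul φ₁ φ₂ x (.compact n) = n • φ₂ (φ₁ x) := by
  have h := isLUB_fracMul hφ₁.monotone hφ₂.monotone hdiv hunp x (.compact n)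
  refine le_antisymm (h.2 ?_) ?_
  · rintro _ ⟨z, ⟨x', hx, a, b, ⟨rfl, ha⟩, hz⟩, rfl⟩
    rw [one_smul] at hz
    rw [← hφ₂.map_nsmul]
    exact hφ₂.monotone (hz.trans (nsmul_mono ha (hφ₁.monotone hx.le)))
  · obtain ⟨s, hs, hx⟩ := CuSemigroup.exists_wayBelow_seq x
    have hs' := wayBelow_seq_monotone hs
    refine (isLUB_nsmul (hφ₂.monotone.comp (hφ₁.monotone.comp hs')) (hφ₂.map_isLUB _ _
      (hφ₁.monotone.comp hs') (hφ₁.map_isLUB _ _ hs' hx)) n).2 ?_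
    rintro _ ⟨k, rfl⟩
    refine h.1 ⟨_, isFracBelow_nsmul (wayBelow_seq_wayBelow hs hx k) le_rfl, ?_⟩
    exact hφ₂.map_nsmul _ _

theorem isMonotoneBiadditive_fracMul : IsMonotoneBiadditive (fracMul φ₁ φ₂) := by
  have hlub := isLUB_fracMul hφ₁.monotone hφ₂.monotone hdiv hunp
  have hdir := isCountablyDirected_fracBelow hφ₁.monotone hφ₂.monotone hdiv hunp
  constructor
  · refine fun u => le_antisymm ((hlub _ _).2 ?_) (CuSemigroup.zero_le' _)
    rintro _ ⟨z, ⟨x', hx, a, b, hab, hz⟩, rfl⟩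
    -- Here x' ≪ 0 forces x' = 0, hence bz ≤ 0, and b ≥ 1 gives z ≤ 0.
    rw [le_antisymm hx.le (CuSemigroup.zero_le' _), hφ₁.map_zero, smul_zero] at hz
    rw [← hφ₂.map_zero]
    refine hφ₂.monotone (le_trans ?_ hz)
    simpa using nsmul_mono (show 1 ≤ b from hab.pos) (le_refl z)
  · intro x
    rw [CuZ.zero_def, fracMul_compact hφ₁ hφ₂ hdiv hunp, zero_smul]
  · intro x y u
    refine le_antisymm ((hlub _ _).2 ?_) ((hdir x u).add_le (hdir y u) (hlub _ _) (hlub _ _) ?_)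
    · rintro _ ⟨z, hz, rfl⟩
      obtain ⟨w, w', hw, hw', hle⟩ :=
        exists_isFracBelow_add_left hφ₁ hφ₂.monotone hdiv hunp hz
      refine hle.trans ?_
      rw [hφ₂.map_add]
      exact add_le_add ((hlub _ _).1 ⟨w, hw, rfl⟩) ((hlub _ _).1 ⟨w', hw', rfl⟩)
    · rintro _ ⟨z, hz, rfl⟩ _ ⟨w, hw, rfl⟩
      rw [← hφ₂.map_add]
      exact (hlub _ _).1 ⟨_, hz.add_left hφ₁ hw, rfl⟩
  · intro x u v
    refine le_antisymm ((hlub _ _).2 ?_) ((hdir x u).add_le (hdir x v) (hlub _ _) (hlub _ _) ?_)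
    · rintro _ ⟨z, hz, rfl⟩
      obtain ⟨w, w', hw, hw', hle⟩ := exists_isFracBelow_add_right hφ₂.monotone hdiv hunp hz
      refine hle.trans ?_
      rw [hφ₂.map_add]
      exact add_le_add ((hlub _ _).1 ⟨w, hw, rfl⟩) ((hlub _ _).1 ⟨w', hw', rfl⟩)
    · rintro _ ⟨z, hz, rfl⟩ _ ⟨w, hw, rfl⟩
      rw [← hφ₂.map_add]
      exact (hlub _ _).1 ⟨_, hz.add_right hφ₁ hw, rfl⟩
  · intro x y u v hxy huv
    refine (hlub _ _).2 ?_
    rintro _ ⟨z, hz, rfl⟩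
    obtain ⟨w, hw, hle⟩ := hz.exists_of_le hunp hxy huv
    exact hle.trans ((hlub _ _).1 ⟨w, hw, rfl⟩)

omit hφ₁ hφ₂

/-- For soft `u` a single pair w' ≪ w in S₂ separates the two values: φ₂(w') bounds the smaller one
and φ₂(w) lies below the larger one. For compact `u` = n, u' may be raised to n and both values are
honest multiples. -/
theorem fracMul_wayBelow (hφ₁ : IsCuMorphism φ₁) (hφ₂ : IsCuMorphism φ₂) {x' x : S₁} {u' u : CuZ}
    (hx : WayBelow x' x) (hu : WayBelow u' u) :
    WayBelow (fracMul φ₁ φ₂ x' u') (fracMul φ₁ φ₂ x u) := by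
  have hg₁ := hφ₁.toIsGeneralizedCuMorphism
  have hg₂ := hφ₂.toIsGeneralizedCuMorphism
  have hlub := isLUB_fracMul hg₁.monotone hg₂.monotone hdiv hunp
  cases u with
  | compact n =>
    refine WayBelow.le_trans
      ((isMonotoneBiadditive_fracMul hg₁ hg₂ hdiv hunp).mono le_rfl hu.le) ?_
    rw [fracMul_compact hg₁ hg₂ hdiv hunp, fracMul_compact hg₁ hg₂ hdiv hunp]
    exact (hφ₂.map_wayBelow (hφ₁.map_wayBelow hx)).nsmul n
  | soft t ht =>
    obtain ⟨p, q, hq, hup, hpt⟩ :=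
      CuZ.exists_natCast_div_between (CuZ.val_lt_of_wayBelow_soft hu)
    obtain ⟨y, hxy, hy⟩ := hx.interpolate
    obtain ⟨w, hw, ⟨c, hc, hcw⟩, -⟩ := exists_isFracBelow hdiv hunp hg₂.monotone hy
      (show (CuZ.soft t ht).DominatesFrac p q from ⟨hq, hpt⟩)
    -- Since (cp)φ₁(x') ≪ (cp)φ₁(y) ≤ (cq)w, the element w can be shrunk to some w' ≪ w that still
    -- satisfies (cp)φ₁(x') ≤ (cq)w'.
    obtain ⟨w', hw', hcw'⟩ := (((hφ₁.map_wayBelow hxy).nsmul (c * p)).trans_le hcw).exists_nsmul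
    refine WayBelow.le_trans ((hlub _ _).2 ?_)
      ((hφ₂.map_wayBelow hw').trans_le ((hlub _ _).1 ⟨w, hw, rfl⟩))
    rintro _ ⟨z, ⟨x'', hx'', a, b, hab, hz⟩, rfl⟩
    refine hunp.map_le_of_nsmul_le
      (hz.trans (nsmul_le_nsmul_right (hg₁.monotone hx''.le) a)) hcw' ?_
    have hlt := (CuZ.natCast_div_lt_div_iff hab.pos hq).1
      (ENNReal.coe_lt_coe.1 (hab.le_val.trans_lt hup))
    calc c * q * a = c * (a * q) := by ring
      _ < c * (p * b) := Nat.mul_lt_mul_of_pos_left hlt hc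
      _ = c * p * b := by ring

end

/-! ### The value at x ⊗ 1 and the conclusion -/

theorem extension_tmul_one {B : S₁ → CuZ → T} (hB : IsMonotoneBiadditive B) {φ : S₁ → T}
    (hφ : IsGeneralizedCuMorphism φ) (h : ∀ x, B x 1 = φ x) (x : S₁) :
    extension B (CuTensor.tmul x 1) = φ x := by
  refine le_antisymm (hB.extension_le ?_) ?_
  · rintro f ⟨x', u, hx, hu, hf⟩
    refine (hB.evalSum_le hf.le).trans ?_
    rw [evalSum_singleton, ← h]
    exact hB.mono hx.le hu.le
  · obtain ⟨s, hs, hx⟩ := CuSemigroup.exists_wayBelow_seq x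
    refine (hφ.map_isLUB s x (wayBelow_seq_monotone hs) hx).2 ?_
    rintro _ ⟨n, rfl⟩
    -- Because 1 ≪ 1, the pure tensor of `s n` with 1 itself belongs to the ideal of x ⊗ 1, so only
    -- the first variable has to be approximated.
    have h1 : WayBelow (1 : CuZ) 1 := CuZ.wayBelow_compact 1
    simpa [h] using hB.le_extension (I := CuTensor.tmul x 1) (f := {(s n, 1)})
      ⟨s (n + 1), 1, wayBelow_seq_wayBelow hs hx _, h1, .singleton (hs n) h1⟩

end Cu

theorem mainTheorem1 {S₁ S₂ T : Type*}
    [AddCommMonoid S₁] [PartialOrder S₁] [Cu.CuSemigroup S₁]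
    [AddCommMonoid S₂] [PartialOrder S₂] [Cu.CuSemigroup S₂]
    [AddCommMonoid T] [PartialOrder T] [Cu.CuSemigroup T]
    (φ₁ : S₁ → S₂) (φ₂ : S₂ → T)
    (hφ₁ : Cu.IsGeneralizedCuMorphism φ₁) (hφ₂ : Cu.IsGeneralizedCuMorphism φ₂)
    (hdiv : Cu.IsAlmostDivisible φ₁) (hunp : Cu.IsAlmostUnperforated φ₂) :
    (∃ β : Cu.CuTensor S₁ Cu.CuZ → T, Cu.IsGeneralizedCuMorphism β ∧
      ∀ x : S₁, β (Cu.CuTensor.tmul x 1) = φ₂ (φ₁ x)) ∧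
    (Cu.IsCuMorphism φ₁ → Cu.IsCuMorphism φ₂ →
      ∃ β : Cu.CuTensor S₁ Cu.CuZ → T, Cu.IsCuMorphism β ∧
        ∀ x : S₁, β (Cu.CuTensor.tmul x 1) = φ₂ (φ₁ x)) := by
  have hB := Cu.isMonotoneBiadditive_fracMul hφ₁ hφ₂ hdiv hunp
  have hone (x : S₁) : Cu.fracMul φ₁ φ₂ x 1 = φ₂ (φ₁ x) :=
    (Cu.fracMul_compact hφ₁ hφ₂ hdiv hunp x 1).trans (one_smul ℕ _)
  have hcomp : Cu.IsGeneralizedCuMorphism fun x => φ₂ (φ₁ x) :=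
    { map_zero := by rw [hφ₁.map_zero, hφ₂.map_zero]
      map_add := fun x y => by rw [hφ₁.map_add, hφ₂.map_add]
      monotone := hφ₂.monotone.comp hφ₁.monotone
      map_isLUB := fun s w hs hw => hφ₂.map_isLUB _ _ (hφ₁.monotone.comp hs)
        (hφ₁.map_isLUB _ _ hs hw) }
  have hext := Cu.extension_tmul_one hB hcomp hone
  exact ⟨⟨_, hB.isGeneralizedCuMorphism_extension, hext⟩, fun h₁ h₂ =>
    ⟨_, hB.isCuMorphism_extension fun hx hu => Cu.fracMul_wayBelow hdiv hunp h₁ h₂ hx hu, hext⟩⟩
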